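/- **Proposition.** Let $(M,\omega)$ be a compact connected Kähler manifold of complex dimension $n$ (so $\omega$ is a smooth closed real $(1,1)$-form with $\omega(u,iu)>0$ for $u\neq0$), with volume form $\Omega=\frac1{n!}\omega^{\wedge n}$. Let $m\ge 1$ be an integer (the level), and let $L$ be a holomorphic line bundle on $M$ with a smooth hermitian metric $h$ (conjugate linear in the first argument) whose Chern connection $\nabla$ has curvature $F(X,Y)=\nabla_X\nabla_Y-\nabla_Y\nabla_X-\nabla_{[X,Y]}=-i\,m\,\omega(X,Y)$. (For $m=1$, $L$ is a quantum line bundle of $(M,\omega)$; the $m$-th tensor power of a quantum line bundle is an instance for general $m$.) For sections of $L$ put $\langle\varphi,\psi\rangle=\int_M h(\varphi,\psi)\,\Omega$. Let $\Gamma_{hol}(M,L)$ be the space of global holomorphic sections, $\Pi$ the orthogonal projection onto it, and for $f\in C^\infty(M)$ (smooth, complex-valued) let $T_f=\Pi\circ(f\,\cdot)\in\mathrm{End}(\Gamma_{hol}(M,L))$ be the Toeplitz operator. Then: 1. $\Gamma_{hol}(M,L)$ is finite-dimensional, and for each $f$ the operator $T_f$ is well defined: it is the unique $A\in \mathrm{End}(\Gamma_{hol}(M,L))$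 with $\langle u,As\rangle=\langle u,fs\rangle$ for all holomorphic $u,s$. 2. The Toeplitz map $C^\infty(M)\to\mathrm{End}(\Gamma_{hol}(M,L))$, $f\mapsto T_f$, is surjective. 3. For $x\in M$ and $0\ne q\in L_x$ there is a unique coherent vector $e_q\in\Gamma_{hol}(M,L)$, that is, a section with $\langle e_q,s\rangle\, q=s(x)$ for all $s\in\Gamma_{hol}(M,L)$. Assume that the holomorphic sections of $L$ have no common zero (for example, that $L$ is very ample), and put, for any $0\neq q\in L_x$, $P_x=\frac{|e_q\rangle\langle e_q|}{\langle e_q,e_q\rangle}$ and $\epsilon(x)=h(q,q)\langle e_q,e_q\rangle$. Then every $A\in\mathrm{End}(\Gamma_{hol}(M,L))$ has a contravariant Berezin symbol: there is $f\in C^\infty(M)$ with $$A=\int_M f(x)\,P_x\,\epsilon(x)\,\Omega(x).$$ -/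

import Mathlib

open scoped Manifold ContDiff Bundle
open MeasureTheory

noncomputable section

namespace BerezinToeplitz

/-- The model space `ℂⁿ` of complex `n`-dimensional manifolds. -/
abbrev Cn (n : ℕ) : Type := EuclideanSpace ℂ (Fin n)

section Forms

variable {n : ℕ} {M : Type*} [TopologicalSpace M] [ChartedSpace (Cn n) M]

/-- A field of real alternating 2-forms on the (real) tangent spaces of `M`. -/
abbrev TwoForm (n : ℕ) (M : Type*) [TopologicalSpace M] [ChartedSpace (Cn n) M] : Type _ :=
  ∀ x : M, TangentSpace 𝓘(ℝ, Cn n) x [⋀^Fin 2]→L[ℝ] ℝ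

/-- The expression `(φ⁻¹)^* κ` of a 2-form `κ` in the chart `φ`, a 2-form on the open set
`φ.target` of `ℂⁿ` (only its values on `φ.target` matter). -/
def formInChart (κ : TwoForm n M) (φ : OpenPartialHomeomorph M (Cn n)) (z : Cn n) :
    Cn n [⋀^Fin 2]→L[ℝ] ℝ :=
  (κ (φ.symm z)).compContinuousLinearMap
    (mfderiv 𝓘(ℝ, Cn n) 𝓘(ℝ, Cn n) φ.symm z : Cn n →L[ℝ] TangentSpace 𝓘(ℝ, Cn n) (φ.symm z))

/-- `κ` is a Kähler form: a smooth closed real 2-form of type `(1,1)` which is positive, i.e.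
`κ(u, iu) > 0` for every tangent vector `u ≠ 0` (so `κ` is in particular nondegenerate). All
conditions are expressed in the holomorphic charts of the complex manifold `M`. -/
structure IsKahlerForm (κ : TwoForm n M) : Prop where
  smooth : ∀ φ ∈ atlas (Cn n) M, ContDiffOn ℝ ∞ (formInChart κ φ) φ.target
  closed : ∀ φ ∈ atlas (Cn n) M, ∀ z ∈ φ.target, extDeriv (formInChart κ φ) z = 0
  type_one_one : ∀ φ ∈ atlas (Cn n) M, ∀ z ∈ φ.target, ∀ u v : Cn n,
    formInChart κ φ z ![Complex.I • u, Complex.I • v] = formInChart κ φ z ![u, v]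
  pos : ∀ φ ∈ atlas (Cn n) M, ∀ z ∈ φ.target, ∀ u : Cn n, u ≠ 0 →
    0 < formInChart κ φ z ![u, Complex.I • u]

/-- The value of the `2n`-form `β^{∧n} / n!` on `2n` vectors indexed by `Fin n × Fin 2`
(in the order `v (0,0), v (0,1), v (1,0), v (1,1), …`):
`(1/n!) (1/2ⁿ) ∑_σ sgn(σ) ∏ᵢ β(v_{σ(i,0)}, v_{σ(i,1)})`. -/
def wedgePowDivFactorial {V : Type*} [AddCommGroup V] [Module ℝ V] [TopologicalSpace V]
    (β : V [⋀^Fin 2]→L[ℝ] ℝ) (v : Fin n × Fin 2 → V) : ℝ :=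
  (1 / ((n.factorial : ℝ) * 2 ^ n)) *
    ∑ σ : Equiv.Perm (Fin n × Fin 2),
      ((Equiv.Perm.sign σ : ℤ) : ℝ) * ∏ i : Fin n, β ![v (σ (i, 0)), v (σ (i, 1))]

/-- The standard oriented real basis `e₁, i e₁, …, eₙ, i eₙ` of `ℂⁿ`, whose dual basis is
`dx₁, dy₁, …, dxₙ, dyₙ`. -/
def realBasis (n : ℕ) (p : Fin n × Fin 2) : Cn n :=
  if p.2 = 0 then EuclideanSpace.single p.1 (1 : ℂ)
  else Complex.I • EuclideanSpace.single p.1 (1 : ℂ)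

/-- The density of `κ^{∧n} / n!` with respect to Lebesgue measure `dx₁ dy₁ ⋯ dxₙ dyₙ` in the
chart `φ`. The absolute value expresses the orientation of `M` in which the volume form is positive
(for a Kähler form this is the orientation given by the complex structure, and the value inside is
itself positive). -/
def liouvilleDensity (κ : TwoForm n M) (φ : OpenPartialHomeomorph M (Cn n)) (z : Cn n) : ℝ :=
  |wedgePowDivFactorial (formInChart κ φ z) (realBasis n)|

variable [MeasurableSpace M]

/-- The measure that the volume form `κ^{∧n} / n!` defines on the domain of the chart `φ`,
extended by zero to `M`. -/
def chartVolume (κ : TwoForm n M) (φ : OpenPartialHomeomorph M (Cn n)) : Measure M :=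
  (((volume : Measure (Cn n)).restrict φ.target).withDensity
    fun z ↦ ENNReal.ofReal (liouvilleDensity κ φ z)).map φ.symm

/-- The measure `Ω` on `M` defined by the volume form `κ^{∧n} / n!`. The measures on the chart
domains agree on overlaps, and `Ω` is their supremum in the lattice of measures: the
measure on `M` that restricts to `chartVolume κ φ` on the domain of each chart `φ`. -/
def liouvilleMeasure (κ : TwoForm n M) : Measure M :=
  ⨆ φ ∈ atlas (Cn n) M, chartVolume κ φ

end Forms

section LineBundle

variable {n : ℕ} {M : Type*} [TopologicalSpace M] [ChartedSpace (Cn n) M]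
  {L : M → Type*} [TopologicalSpace (Bundle.TotalSpace ℂ L)]
  [∀ x, AddCommGroup (L x)] [∀ x, Module ℂ (L x)]
  [∀ x, TopologicalSpace (L x)] [FiberBundle ℂ L]

/-- The local frame `x ↦ e⁻¹(x, 1)` of a line bundle defined by a local trivialization `e`; it is
holomorphic if `e` is a trivialization of a holomorphic line bundle. -/
def localFrame (e : Bundle.Trivialization ℂ (Bundle.TotalSpace.proj : Bundle.TotalSpace ℂ L → M))
    (x : M) : L x :=
  e.symm x 1

variable (n L) in
/-- A smooth hermitian metric on the complex line bundle `L`, conjugate linear in the first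
argument. -/
structure HermitianMetric where
  /-- The hermitian form on the fibre over `x`. -/
  form : ∀ x : M, L x →ₗ⋆[ℂ] L x →ₗ[ℂ] ℂ
  conj_symm : ∀ (x : M) (u v : L x), starRingEnd ℂ (form x u v) = form x v u
  pos : ∀ (x : M) (u : L x), u ≠ 0 → 0 < (form x u u).re
  smooth : ∀ (e : Bundle.Trivialization ℂ (Bundle.TotalSpace.proj : Bundle.TotalSpace ℂ L → M))
    [MemTrivializationAtlas e],
    ContMDiffOn 𝓘(ℝ, Cn n) 𝓘(ℝ, ℂ) ∞
      (fun x ↦ form x (localFrame e x) (localFrame e x)) e.baseSet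

/-- The function `log ĥ`, `ĥ = h(s, s)`, for the local holomorphic frame `s` defined by the
trivialization `e`, in the chart `φ`. -/
def logWeight (h : HermitianMetric n L)
    (e : Bundle.Trivialization ℂ (Bundle.TotalSpace.proj : Bundle.TotalSpace ℂ L → M))
    (φ : OpenPartialHomeomorph M (Cn n)) (z : Cn n) : ℝ :=
  Real.log (h.form (φ.symm z) (localFrame e (φ.symm z)) (localFrame e (φ.symm z))).re

/-- The complex structure of `ℂⁿ` as a real linear map. -/
def mulI (n : ℕ) : Cn n →L[ℝ] Cn n :=
  (Complex.I • ContinuousLinearMap.id ℂ (Cn n)).restrictScalars ℝ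

/-- The `(1,0)`-form `∂ψ = ∑ⱼ (∂ψ/∂zⱼ) dzⱼ`, that is
`∂ψ(v) = (dψ(v) - i dψ(iv)) / 2`, of a real function `ψ` on `ℂⁿ`. -/
def delForm (ψ : Cn n → ℝ) (z : Cn n) : Cn n [⋀^Fin 1]→L[ℝ] ℂ :=
  ContinuousAlternatingMap.ofSubsingleton ℝ (Cn n) ℂ (0 : Fin 1)
    ((1 / 2 : ℂ) • (Complex.ofRealCLM ∘L fderiv ℝ ψ z -
      Complex.I • (Complex.ofRealCLM ∘L fderiv ℝ ψ z ∘L mulI n)))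

/-- The curvature form of the Chern connection `∇` of `(L, h)`, in the chart `φ`. In the holomorphic
frame given by `e` this connection is `∇ = d + θ` with connection form `θ = ∂ log ĥ`, and
its curvature `F(X, Y) = ∇_X ∇_Y - ∇_Y ∇_X - ∇_{[X, Y]}` is `dθ`, which equals `∂̄∂ log ĥ`. -/
def chernCurvature (h : HermitianMetric n L)
    (e : Bundle.Trivialization ℂ (Bundle.TotalSpace.proj : Bundle.TotalSpace ℂ L → M))
    (φ : OpenPartialHomeomorph M (Cn n)) (z : Cn n) : Cn n [⋀^Fin 2]→L[ℝ] ℂ :=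
  extDeriv (delForm (logWeight h e φ)) z

/-- The quantization condition at level `m`: the curvature of `(L, h)` is `F = -i m κ`. For `m = 1`
this says that `(L, h)` with its Chern connection is a quantum line bundle of `(M, κ)`; the `m`-th
tensor power of a quantum line bundle, with the induced metric, has level `m`. -/
def IsQuantumLineBundle (κ : TwoForm n M) (h : HermitianMetric n L) (m : ℕ) : Prop :=
  ∀ φ ∈ atlas (Cn n) M,
  ∀ (e : Bundle.Trivialization ℂ (Bundle.TotalSpace.proj : Bundle.TotalSpace ℂ L → M))
    [MemTrivializationAtlas e],
  ∀ z ∈ φ.target, φ.symm z ∈ e.baseSet → ∀ u v : Cn n,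
    chernCurvature h e φ z ![u, v] = -Complex.I * m * (formInChart κ φ z ![u, v] : ℂ)

variable (n L) in
/-- `Γ_hol(M, L)`, the complex vector space of global holomorphic sections of `L`. -/
abbrev HolSection [VectorBundle ℂ ℂ L] : Type _ :=
  ContMDiffSection 𝓘(ℂ, Cn n) ℂ ω L

variable (n M) in
/-- `C^∞(M)`, the smooth (in the real sense) complex valued functions on `M`. -/
abbrev SmoothFun : Type _ := C^∞⟮𝓘(ℝ, Cn n), M; 𝓘(ℝ, ℂ), ℂ⟯

/-- The linear form `q̂` on `Γ_hol(M, L)` for a nonzero `q` in the fibre over `x`, given by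
`s(x) = q̂(s) q` (see `evalForm_smul`). -/
def evalForm [VectorBundle ℂ ℂ L] (h : HermitianMetric n L) {x : M} (q : L x) :
    HolSection n L →ₗ[ℂ] ℂ where
  toFun s := (h.form x q q)⁻¹ * h.form x q (s x)
  map_add' s t := by simp [mul_add]
  map_smul' c s := by simp [mul_left_comm]

/-- The defining property of `q̂`. -/
theorem evalForm_smul [VectorBundle ℂ ℂ L] (h : HermitianMetric n L) {x : M} (q : L x)
    (hq : q ≠ 0) (s : HolSection n L) : evalForm h q s • q = s x := by
  have hx : x ∈ (trivializationAt ℂ L x).baseSet := FiberBundle.mem_baseSet_trivializationAt' x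
  set t := (trivializationAt ℂ L x).continuousLinearEquivAt ℂ x hx with ht
  have htq : t q ≠ 0 := fun h0 ↦ hq (t.map_eq_zero_iff.1 h0)
  have hc : s x = (t (s x) / t q) • q := by
    apply t.injective
    rw [map_smul, smul_eq_mul, div_mul_cancel₀ _ htq]
  have hqq : h.form x q q ≠ 0 := fun h0 ↦ by
    have := h.pos x q hq
    rw [h0] at this
    simp at this
  have hv : evalForm h q s = t (s x) / t q := by
    change (h.form x q q)⁻¹ * h.form x q (s x) = _
    conv_lhs => rw [hc, map_smul, smul_eq_mul]
    field_simp
  rw [hv, ← hc]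

variable [MeasurableSpace M]

/-- The scalar product `⟨φ, ψ⟩ = ∫_M h(φ, ψ) Ω` of sections of `L`. -/
def l2Inner (κ : TwoForm n M) (h : HermitianMetric n L) (φ ψ : ∀ x, L x) : ℂ :=
  ∫ x, h.form x (φ x) (ψ x) ∂(liouvilleMeasure κ)

variable [VectorBundle ℂ ℂ L]

/-- `t = Π φ`: the holomorphic section `t` is the orthogonal projection of the section `φ` to
`Γ_hol(M, L)`, i.e. `⟨u, φ⟩ = ⟨u, t⟩` for all holomorphic `u`. -/
def IsHolProjection (κ : TwoForm n M) (h : HermitianMetric n L) (φ : ∀ x, L x)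
    (t : HolSection n L) : Prop :=
  ∀ u : HolSection n L, l2Inner κ h u φ = l2Inner κ h u t

/-- `A` is the Toeplitz operator `T_f = Π ∘ (f ·)` on `Γ_hol(M, L)`. -/
def IsToeplitz (κ : TwoForm n M) (h : HermitianMetric n L) (f : SmoothFun n M)
    (A : Module.End ℂ (HolSection n L)) : Prop :=
  ∀ s : HolSection n L, IsHolProjection κ h (fun x ↦ f x • s x) (A s)

open Classical in
/-- The Toeplitz map `f ↦ T_f`. (The default value `0` is never used under the assumptions of the
theorem, which asserts that there is exactly one `A` with `IsToeplitz κ h f A`.) -/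
def toeplitz (κ : TwoForm n M) (h : HermitianMetric n L) (f : SmoothFun n M) :
    Module.End ℂ (HolSection n L) :=
  if hA : ∃ A, IsToeplitz κ h f A then hA.choose else 0

/-- `e` is the coherent vector `e_q` associated to `q`: `⟨e, s⟩ = q̂(s)` for all holomorphic `s`. -/
def IsCoherentVector (κ : TwoForm n M) (h : HermitianMetric n L) {x : M} (q : L x)
    (e : HolSection n L) : Prop :=
  ∀ s : HolSection n L, l2Inner κ h e s = evalForm h q s

open Classical in
/-- The coherent vector `e_q`. (The default value `0` is never used for `q ≠ 0` under the
assumptions of the theorem, which asserts existence and uniqueness of `e_q`.) -/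
def coherentVector (κ : TwoForm n M) (h : HermitianMetric n L) {x : M} (q : L x) :
    HolSection n L :=
  if he : ∃ e, IsCoherentVector κ h q e then he.choose else 0

/-- The coherent projector `P_x = |e_q⟩⟨e_q| / ⟨e_q, e_q⟩`, `0 ≠ q ∈ L_x`; here the linear form
`⟨e_q, ·⟩` is `q̂`. -/
def coherentProjector (κ : TwoForm n M) (h : HermitianMetric n L) {x : M} (q : L x) :
    Module.End ℂ (HolSection n L) :=
  (l2Inner κ h (coherentVector κ h q) (coherentVector κ h q))⁻¹ •
    (evalForm h q).smulRight (coherentVector κ h q)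

/-- Rawnsley's epsilon function `ε(x) = |q|² ⟨e_q, e_q⟩`, `0 ≠ q ∈ L_x`, with `|q|² = h(q, q)`. -/
def rawnsleyEpsilon (κ : TwoForm n M) (h : HermitianMetric n L) {x : M} (q : L x) : ℂ :=
  h.form x q q * l2Inner κ h (coherentVector κ h q) (coherentVector κ h q)

/-- `f` is a contravariant Berezin symbol of `A`, i.e. `A = ∫_M f(x) P_x ε(x) Ω(x)`. The integral of
the operator valued function is understood through all linear functionals `ℓ` on the finite
dimensional space of operators. The points `q x` of the fibres by which `P_x` and `ε(x)` are
expressed may be any nonzero ones. -/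
def IsContravariantSymbol (κ : TwoForm n M) (h : HermitianMetric n L)
    (A : Module.End ℂ (HolSection n L)) (f : SmoothFun n M) : Prop :=
  ∀ q : ∀ x, L x, (∀ x, q x ≠ 0) → ∀ ℓ : Module.Dual ℂ (Module.End ℂ (HolSection n L)),
    Integrable (fun x ↦ f x * ℓ (coherentProjector κ h (q x)) * rawnsleyEpsilon κ h (q x))
      (liouvilleMeasure κ) ∧
    ℓ A = ∫ x, f x * ℓ (coherentProjector κ h (q x)) * rawnsleyEpsilon κ h (q x)
      ∂(liouvilleMeasure κ)

end LineBundle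

end BerezinToeplitz

end

/-! Surjectivity is a duality argument. In an orthonormal basis `b` of the space of holomorphic
sections, a linear functional on operators has the form `l A = ∑ c i j ⟨b i, A (b j)⟩`, hence `l
(T_f) = ∫ f K Ω` with `K = ∑ c i j h(b i, b j)`. If `l` kills all Toeplitz operators, then `f = conj
K` gives `∫ |K|² Ω = 0`. Since `Ω` charges open sets, `K = 0`. In a local holomorphic frame `K` is a
positive weight times `∑ c i j conj(F i) F j` with `F i` holomorphic. Polarization separates the
conjugated from the holomorphic variable, and the identity theorem together with linear
independence, used once per variable, yields `c = 0` (`coeff_eq_zero_of_sum_form_eq_zero`). Thus no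
nonzero functional kills the range (`exists_isToeplitz`).

The contravariant symbol is the same statement: `P_x ε(x)` has matrix entries `h(b i, b j)` at `x`
(`dual_coherentProjector_mul_epsilon`), so `∫ f P ε Ω = T_f`.

The analytic input is finite dimension, from the Schwarz lemma and compactness
(`finiteDimensional_holSection`), and that `Ω` is finite and positive on nonempty open sets. Given
an orthonormal basis, `T_f` and the coherent vectors are instances of Riesz representation. -/

noncomputable section

namespace BerezinToeplitz

/-! ### Local frames and holomorphic coordinates. -/

section Local

variable {n : ℕ} {M : Type*} [TopologicalSpace M] [ChartedSpace (Cn n) M]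

/-- The real manifold underlying a complex manifold. -/
theorem isManifold_real [IsManifold 𝓘(ℂ, Cn n) ω M] (k : ℕ∞ω) : IsManifold 𝓘(ℝ, Cn n) k M := by
  have : IsManifold 𝓘(ℝ, Cn n) ω M := by
    refine isManifold_of_contDiffOn _ _ _ fun e e' he he' ↦ ?_
    have h := (contDiffGroupoid ω 𝓘(ℂ, Cn n)).compatible he he'
    rw [contDiffGroupoid, mem_groupoid_of_pregroupoid] at h
    exact ContDiffOn.restrict_scalars ℝ h.1
  exact IsManifold.of_le (n := ω) le_top

theorem contMDiffOn_real {f : M → ℂ} {s : Set M} {k : ℕ∞ω}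
    (hf : ContMDiffOn 𝓘(ℂ, Cn n) 𝓘(ℂ, ℂ) k f s) : ContMDiffOn 𝓘(ℝ, Cn n) 𝓘(ℝ, ℂ) k f s := by
  intro x hx
  have := contMDiffWithinAt_iff.1 (hf x hx)
  exact contMDiffWithinAt_iff.2 ⟨this.1, this.2.restrict_scalars ℝ⟩

variable {L : M → Type*} [TopologicalSpace (Bundle.TotalSpace ℂ L)]
  [∀ x, AddCommGroup (L x)] [∀ x, Module ℂ (L x)]
  [∀ x, TopologicalSpace (L x)] [FiberBundle ℂ L] [VectorBundle ℂ ℂ L]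

theorem eq_smul_localFrame
    (e : Bundle.Trivialization ℂ (Bundle.TotalSpace.proj : Bundle.TotalSpace ℂ L → M))
    [MemTrivializationAtlas e] {x : M} (hx : x ∈ e.baseSet) (v : L x) :
    v = e.linearMapAt ℂ x v • localFrame e x := by
  apply (e.continuousLinearEquivAt ℂ x hx).injective
  rw [map_smul]
  have h1 : e.continuousLinearEquivAt ℂ x hx (localFrame e x) = 1 := by
    simp [localFrame, e.apply_mk_symm hx]
  rw [h1]
  simp [e.coe_linearMapAt_of_mem hx]

theorem localFrame_ne_zero
    (e : Bundle.Trivialization ℂ (Bundle.TotalSpace.proj : Bundle.TotalSpace ℂ L → M))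
    [MemTrivializationAtlas e] {x : M} (hx : x ∈ e.baseSet) : localFrame e x ≠ 0 := by
  intro h0
  have h1 : e.continuousLinearEquivAt ℂ x hx (localFrame e x) = 1 := by
    simp [localFrame, e.apply_mk_symm hx]
  rw [h0, map_zero] at h1
  exact zero_ne_one h1

omit [VectorBundle ℂ ℂ L] in
theorem HermitianMetric.form_self_eq_re (h : HermitianMetric n L) {x : M} (u : L x) :
    h.form x u u = ((h.form x u u).re : ℂ) :=
  (Complex.conj_eq_iff_re.1 (h.conj_symm x u u)).symm

omit [VectorBundle ℂ ℂ L] in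
theorem HermitianMetric.form_self_eq_zero (h : HermitianMetric n L) {x : M} {u : L x} :
    h.form x u u = 0 ↔ u = 0 := by
  refine ⟨fun h0 ↦ ?_, fun h0 ↦ by simp [h0]⟩
  by_contra hu
  have := h.pos x u hu
  simp [h0] at this

omit [VectorBundle ℂ ℂ L] in
theorem HermitianMetric.form_self_re_nonneg (h : HermitianMetric n L) {x : M} (u : L x) :
    0 ≤ (h.form x u u).re := by
  by_cases hu : u = 0
  · simp [hu]
  · exact (h.pos x u hu).le

theorem HermitianMetric.form_eq_local (h : HermitianMetric n L)
    (e : Bundle.Trivialization ℂ (Bundle.TotalSpace.proj : Bundle.TotalSpace ℂ L → M))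
    [MemTrivializationAtlas e] {x : M} (hx : x ∈ e.baseSet) (u v : L x) :
    h.form x u v = starRingEnd ℂ (e.linearMapAt ℂ x u) * e.linearMapAt ℂ x v *
      h.form x (localFrame e x) (localFrame e x) := by
  conv_lhs => rw [eq_smul_localFrame e hx u, eq_smul_localFrame e hx v]
  simp only [map_smulₛₗ, LinearMap.smul_apply, smul_eq_mul, RingHom.id_apply]
  ring

variable [ContMDiffVectorBundle ω ℂ L 𝓘(ℂ, Cn n)]

theorem contMDiffOn_linearMapAt
    (e : Bundle.Trivialization ℂ (Bundle.TotalSpace.proj : Bundle.TotalSpace ℂ L → M))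
    [MemTrivializationAtlas e] (s : HolSection n L) :
    ContMDiffOn 𝓘(ℂ, Cn n) 𝓘(ℂ, ℂ) ω (fun x ↦ e.linearMapAt ℂ x (s x)) e.baseSet := by
  have := (e.contMDiffOn_section_baseSet_iff (IB := 𝓘(ℂ, Cn n)) (n := ω)).1 s.contMDiff.contMDiffOn
  exact this.congr fun x hx ↦ by simp [e.coe_linearMapAt_of_mem hx]

/-- The pointwise scalar product of two holomorphic sections is smooth. -/
theorem contMDiff_form (h : HermitianMetric n L) (s t : HolSection n L) :
    ContMDiff 𝓘(ℝ, Cn n) 𝓘(ℝ, ℂ) ∞ fun x ↦ h.form x (s x) (t x) := by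
  intro x
  set e := trivializationAt ℂ L x
  have hx : x ∈ e.baseSet := FiberBundle.mem_baseSet_trivializationAt' x
  have key : ContMDiffOn 𝓘(ℝ, Cn n) 𝓘(ℝ, ℂ) ∞ (fun x ↦ h.form x (s x) (t x)) e.baseSet := by
    have hs := (contMDiffOn_real (contMDiffOn_linearMapAt e s)).of_le (m := ∞) le_top
    have ht := (contMDiffOn_real (contMDiffOn_linearMapAt e t)).of_le (m := ∞) le_top
    have hs' : ContMDiffOn 𝓘(ℝ, Cn n) 𝓘(ℝ, ℂ) ∞
        (fun x ↦ starRingEnd ℂ (e.linearMapAt ℂ x (s x))) e.baseSet :=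
      Complex.conjCLE.contDiff.contMDiff.comp_contMDiffOn hs
    have hmul : ContMDiff 𝓘(ℝ, ℂ × ℂ) 𝓘(ℝ, ℂ) ∞ fun p : ℂ × ℂ ↦ p.1 * p.2 :=
      contDiff_mul.contMDiff
    exact (hmul.comp_contMDiffOn ((hmul.comp_contMDiffOn (hs'.prodMk_space ht)).prodMk_space
      (h.smooth e))).congr fun y hy ↦ h.form_eq_local e hy _ _
  exact key.contMDiffAt (e.open_baseSet.mem_nhds hx)

/-- Local coordinates at a point together with a local holomorphic frame of `L`. -/
theorem exists_local_model [IsManifold 𝓘(ℂ, Cn n) ω M] (h : HermitianMetric n L) (x : M) :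
    ∃ (R : ℝ) (p : Cn n → M) (c : HolSection n L →ₗ[ℂ] (Cn n → ℂ)) (w : Cn n → ℝ),
      0 < R ∧ p 0 = x ∧ (∀ U ⊆ Metric.ball 0 R, IsOpen U → IsOpen (p '' U)) ∧
      ContinuousOn p (Metric.ball 0 R) ∧
      (∀ s, AnalyticOnNhd ℂ (c s) (Metric.ball 0 R)) ∧ ContinuousOn w (Metric.ball 0 R) ∧
      (∀ z ∈ Metric.ball 0 R, 0 < w z) ∧
      ∀ s t : HolSection n L, ∀ z ∈ Metric.ball 0 R,
        h.form (p z) (s (p z)) (t (p z)) = starRingEnd ℂ (c s z) * c t z * w z := by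
  set e := trivializationAt ℂ L x
  have hx : x ∈ e.baseSet := FiberBundle.mem_baseSet_trivializationAt' x
  set φ := chartAt (Cn n) x
  have hφ : φ ∈ atlas (Cn n) M := chart_mem_atlas _ x
  have hxφ : x ∈ φ.source := mem_chart_source _ x
  have hUo : IsOpen (φ.target ∩ φ.symm ⁻¹' e.baseSet) :=
    φ.isOpen_inter_preimage_symm e.open_baseSet
  have hxU : φ x ∈ φ.target ∩ φ.symm ⁻¹' e.baseSet :=
    ⟨φ.map_source hxφ, by simpa [φ.left_inv hxφ] using hx⟩
  obtain ⟨R, hR, hball⟩ := Metric.isOpen_iff.1 hUo _ hxU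
  have htr : ∀ z ∈ Metric.ball (0 : Cn n) R, z + φ x ∈ φ.target ∩ φ.symm ⁻¹' e.baseSet := by
    intro z hz
    apply hball
    simpa [Metric.mem_ball, dist_eq_norm] using hz
  have hsymm : ContMDiffOn 𝓘(ℂ, Cn n) 𝓘(ℂ, Cn n) ω φ.symm φ.target :=
    contMDiffOn_symm_of_mem_maximalAtlas (IsManifold.subset_maximalAtlas hφ)
  have hpc : ContinuousOn (fun z ↦ φ.symm (z + φ x)) (Metric.ball 0 R) :=
    φ.continuousOn_symm.comp (by fun_prop) fun z hz ↦ (htr z hz).1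
  -- The chart is translated so that `x` sits at `0`, the centre used in the Schwarz lemma and in
  -- polarization. `c s` is the coefficient of `s` in the frame, and `w` the squared norm of the
  -- frame.
  refine ⟨R, fun z ↦ φ.symm (z + φ x),
    { toFun := fun s z ↦ e.linearMapAt ℂ (φ.symm (z + φ x)) (s (φ.symm (z + φ x)))
      map_add' := fun s t ↦ by ext z; simp
      map_smul' := fun a s ↦ by ext z; simp },
    fun z ↦ (h.form (φ.symm (z + φ x)) (localFrame e (φ.symm (z + φ x)))
      (localFrame e (φ.symm (z + φ x)))).re, hR, by simp [φ.left_inv hxφ], ?_, hpc, ?_, ?_, ?_, ?_⟩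
  · intro U hU hUo
    have : (fun z ↦ φ.symm (z + φ x)) '' U = φ.symm '' ((fun z ↦ z + φ x) '' U) := by
      rw [Set.image_image]
    rw [this]
    refine φ.symm.isOpen_image_of_subset_source ((Homeomorph.addRight (φ x)).isOpenMap _ hUo) ?_
    rintro _ ⟨z, hz, rfl⟩
    exact (htr z (hU hz)).1
  · intro s
    have h1 : ContMDiffOn 𝓘(ℂ, Cn n) 𝓘(ℂ, ℂ) ω
        (fun z ↦ e.linearMapAt ℂ (φ.symm z) (s (φ.symm z)))
        (φ.target ∩ φ.symm ⁻¹' e.baseSet) :=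
      (contMDiffOn_linearMapAt e s).comp (hsymm.mono Set.inter_subset_left) fun z hz ↦ hz.2
    have h2 := (hUo.analyticOn_iff_analyticOnNhd).1 (contMDiffOn_iff_contDiffOn.1 h1).analyticOn
    refine h2.comp (g := fun z ↦ e.linearMapAt ℂ (φ.symm z) (s (φ.symm z)))
      (f := fun z ↦ z + φ x) ?_ htr
    exact analyticOnNhd_id.add analyticOnNhd_const
  · refine Complex.continuous_re.comp_continuousOn ?_
    exact (h.smooth e).continuousOn.comp hpc fun z hz ↦ (htr z hz).2
  · intro z hz
    exact h.pos _ _ (localFrame_ne_zero e (htr z hz).2)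
  · intro s t z hz
    rw [h.form_eq_local e (htr z hz).2, ← h.form_self_eq_re]
    rfl

end Local

/-! ### Polarization of sesquilinear expressions in holomorphic functions. -/

section Polarization

/-- One variable polarization: a sesquilinear expression in holomorphic functions on a disc which
vanishes on the diagonal vanishes if the conjugated factors are evaluated at the centre. -/
theorem sum_conj_mul_eq_zero_of_diagonal {ι : Type*} [Fintype ι] (c : ι → ι → ℂ) (F : ι → ℂ → ℂ)
    {R : ℝ} (hF : ∀ i, DifferentiableOn ℂ (F i) (Metric.ball 0 R))
    (h0 : ∀ t ∈ Metric.ball (0 : ℂ) R, ∑ i, ∑ j, c i j * (starRingEnd ℂ (F i t) * F j t) = 0)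
    {t : ℂ} (ht : t ∈ Metric.ball (0 : ℂ) R) :
    ∑ i, ∑ j, c i j * (starRingEnd ℂ (F i 0) * F j t) = 0 := by
  -- For real `x`, `y` the two arguments coincide, and `G x y` is the diagonal sum at `x + iy`. For
  -- complex `x`, `y` they are independent, and `G` is holomorphic in each variable because the two
  -- conjugations cancel.
  set G : ℂ → ℂ → ℂ := fun x y ↦ ∑ i, ∑ j, c i j *
    (starRingEnd ℂ (F i (starRingEnd ℂ (x - Complex.I * y))) * F j (x + Complex.I * y)) with hG
  have hFc : ∀ i, DifferentiableOn ℂ (fun z ↦ starRingEnd ℂ (F i (starRingEnd ℂ z)))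
      (Metric.ball 0 R) := by
    intro i z hz
    have hz' : starRingEnd ℂ z ∈ Metric.ball (0 : ℂ) R := by simpa using hz
    have h1 := DifferentiableAt.conj_conj
      ((hF i).differentiableAt (Metric.isOpen_ball.mem_nhds hz'))
    rw [starRingEnd_self_apply] at h1
    exact h1.differentiableWithinAt
  have hmem : ∀ x ∈ Metric.ball (0 : ℂ) (R / 2), ∀ y ∈ Metric.ball (0 : ℂ) (R / 2),
      x + Complex.I * y ∈ Metric.ball (0 : ℂ) R ∧ x - Complex.I * y ∈ Metric.ball (0 : ℂ) R := by
    intro x hx y hy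
    simp only [mem_ball_zero_iff] at hx hy ⊢
    have h1 := norm_add_le x (Complex.I * y)
    have h2 := norm_sub_le x (Complex.I * y)
    simp only [norm_mul, Complex.norm_I, one_mul] at h1 h2
    constructor <;> linarith
  have hR : 0 < R := (norm_nonneg t).trans_lt (by simpa using ht)
  -- Identity theorem: the real points of the disc accumulate at `0`. It is applied first in `y`,
  -- then in `x`.
  have hreal : ∀ g : ℂ → ℂ, DifferentiableOn ℂ g (Metric.ball 0 (R / 2)) →
      (∀ x : ℝ, (x : ℂ) ∈ Metric.ball (0 : ℂ) (R / 2) → g x = 0) →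
      ∀ x ∈ Metric.ball (0 : ℂ) (R / 2), g x = 0 := by
    intro g hg hg0 x hx
    have h0 : (0 : ℂ) ∈ Metric.ball (0 : ℂ) (R / 2) := Metric.mem_ball_self (by linarith)
    refine (hg.analyticOnNhd Metric.isOpen_ball).eqOn_zero_of_preconnected_of_frequently_eq_zero
      (convex_ball _ _).isPreconnected h0 ?_ hx
    have htend : Filter.Tendsto (fun x : ℝ ↦ (x : ℂ)) (nhdsWithin 0 {0}ᶜ) (nhdsWithin 0 {0}ᶜ) := by
      refine tendsto_nhdsWithin_iff.2 ⟨?_, ?_⟩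
      · exact (Complex.continuous_ofReal.tendsto' 0 0 (by simp)).mono_left nhdsWithin_le_nhds
      · filter_upwards [self_mem_nhdsWithin] with y hy
        simpa using hy
    refine htend.frequently (Filter.Eventually.frequently ?_)
    have : ∀ᶠ y : ℝ in nhds 0, (y : ℂ) ∈ Metric.ball (0 : ℂ) (R / 2) :=
      Complex.continuous_ofReal.continuousAt.eventually_mem
        (by simpa using Metric.isOpen_ball.mem_nhds h0)
    filter_upwards [this.filter_mono nhdsWithin_le_nhds] with y hy using hg0 y hy
  have hG1 : ∀ x : ℝ, (x : ℂ) ∈ Metric.ball (0 : ℂ) (R / 2) →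
      ∀ y ∈ Metric.ball (0 : ℂ) (R / 2), G x y = 0 := by
    intro x hx
    refine hreal _ ?_ ?_
    · refine DifferentiableOn.fun_sum fun i _ ↦ DifferentiableOn.fun_sum fun j _ ↦
        DifferentiableOn.const_mul (DifferentiableOn.mul ?_ ?_) _
      · exact (hFc i).comp (f := fun y ↦ (x : ℂ) - Complex.I * y) (by fun_prop)
          fun y hy ↦ (hmem x hx y hy).2
      · exact (hF j).comp (f := fun y ↦ (x : ℂ) + Complex.I * y) (by fun_prop)
          fun y hy ↦ (hmem x hx y hy).1
    · intro y hy
      simpa [hG] using h0 _ (hmem x hx y hy).1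
  have hG2 : ∀ y ∈ Metric.ball (0 : ℂ) (R / 2), ∀ x ∈ Metric.ball (0 : ℂ) (R / 2), G x y = 0 := by
    intro y hy
    refine hreal (fun x ↦ G x y) ?_ fun x hx ↦ hG1 x hx y hy
    refine DifferentiableOn.fun_sum fun i _ ↦ DifferentiableOn.fun_sum fun j _ ↦
      DifferentiableOn.const_mul (DifferentiableOn.mul ?_ ?_) _
    · exact (hFc i).comp (f := fun x ↦ x - Complex.I * y) (by fun_prop)
        fun x hx ↦ (hmem x hx y hy).2
    · exact (hF j).comp (f := fun x ↦ x + Complex.I * y) (by fun_prop)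
        fun x hx ↦ (hmem x hx y hy).1
  have ht' : ‖t‖ < R := by simpa using ht
  -- The solution of `x - iy = 0`, `x + iy = t`; both coordinates have norm `‖t‖ / 2 < R / 2`.
  have key := hG2 (-(Complex.I * (t / 2))) (by simp; linarith) (t / 2) (by simp; linarith)
  have e1 : t / 2 - Complex.I * -(Complex.I * (t / 2)) = 0 := by
    linear_combination (t / 2) * Complex.I_mul_I
  have e2 : t / 2 + Complex.I * -(Complex.I * (t / 2)) = t := by
    linear_combination (-t / 2) * Complex.I_mul_I
  simpa only [hG, e1, e2, map_zero] using key

/-- Polarization on a ball of a normed space. -/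
theorem sum_conj_mul_eq_zero_of_diagonal_ball {E : Type*} [NormedAddCommGroup E] [NormedSpace ℂ E]
    {ι : Type*} [Fintype ι] (c : ι → ι → ℂ) (f : ι → E → ℂ)
    {R : ℝ} (hf : ∀ i, DifferentiableOn ℂ (f i) (Metric.ball 0 R))
    (h0 : ∀ z ∈ Metric.ball (0 : E) R, ∑ i, ∑ j, c i j * (starRingEnd ℂ (f i z) * f j z) = 0)
    {z : E} (hz : z ∈ Metric.ball (0 : E) R) :
    ∑ i, ∑ j, c i j * (starRingEnd ℂ (f i 0) * f j z) = 0 := by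
  rcases eq_or_ne z 0 with rfl | hz0
  · exact h0 0 hz
  have hzn : 0 < ‖z‖ := norm_pos_iff.2 hz0
  -- Restrict to the complex line through `z`, where the point of interest is `t = 1`.
  have hm : Set.MapsTo (fun t : ℂ ↦ t • z) (Metric.ball 0 (R / ‖z‖)) (Metric.ball 0 R) := by
    intro t ht
    simp only [mem_ball_zero_iff, norm_smul] at ht ⊢
    rwa [lt_div_iff₀ hzn] at ht
  have h1 : (1 : ℂ) ∈ Metric.ball (0 : ℂ) (R / ‖z‖) := by
    simp only [mem_ball_zero_iff, norm_one] at hz ⊢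
    rwa [lt_div_iff₀ hzn, one_mul]
  have := sum_conj_mul_eq_zero_of_diagonal c (fun i t ↦ f i (t • z)) (R := R / ‖z‖)
    (fun i ↦ (hf i).comp (f := fun t : ℂ ↦ t • z) (by fun_prop) hm) (fun t ht ↦ h0 _ (hm ht)) h1
  simpa using this

end Polarization

/-! ### Finite dimension, the identity theorem, and independence of the functions `h(b i, b j)`. -/

section Global

variable {n : ℕ} {M : Type*} [TopologicalSpace M] [ChartedSpace (Cn n) M]
  [IsManifold 𝓘(ℂ, Cn n) ω M]
  {L : M → Type*} [TopologicalSpace (Bundle.TotalSpace ℂ L)]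
  [∀ x, AddCommGroup (L x)] [∀ x, Module ℂ (L x)]
  [∀ x, TopologicalSpace (L x)] [FiberBundle ℂ L] [VectorBundle ℂ ℂ L]
  [ContMDiffVectorBundle ω ℂ L 𝓘(ℂ, Cn n)]

theorem re_conj_mul_self_mul (a : ℂ) (r : ℝ) :
    (starRingEnd ℂ a * a * (r : ℂ)).re = ‖a‖ ^ 2 * r := by
  rw [Complex.conj_mul', ← Complex.ofReal_pow, ← Complex.ofReal_mul, Complex.ofReal_re]

/-- A bounded holomorphic section vanishing at `x` is small near `x`, uniformly in the section. -/
theorem exists_nhds_norm_sq_le_half (h : HermitianMetric n L) (x : M) :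
    ∃ W ∈ nhds x, ∀ s : HolSection n L, s x = 0 → ∀ N : ℝ,
      (∀ y, (h.form y (s y) (s y)).re ≤ N) → ∀ y ∈ W, (h.form y (s y) (s y)).re ≤ N / 2 := by
  obtain ⟨R, p, c, w, hR, hp0, hop, -, hc, hwc, hw, hform⟩ := exists_local_model h x
  have h0 : (0 : Cn n) ∈ Metric.ball (0 : Cn n) R := Metric.mem_ball_self hR
  have hw0 := hw 0 h0
  have hnear : ∀ᶠ z in nhds (0 : Cn n), w z ∈ Set.Ioo (w 0 / 2) (2 * w 0) :=
    (hwc.continuousAt (Metric.isOpen_ball.mem_nhds h0)).eventually_mem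
      (Ioo_mem_nhds (by linarith) (by linarith))
  obtain ⟨R₁, hR₁, hball⟩ := Metric.eventually_nhds_iff_ball.1
    (hnear.and (Metric.isOpen_ball.mem_nhds h0))
  -- On a quarter of the radius the Schwarz lemma gains a factor `1/16` in the squared norm, while
  -- the oscillation of `w` costs at most `4`; this leaves `N / 4`.
  have hsub : Metric.ball (0 : Cn n) (R₁ / 4) ⊆ Metric.ball 0 R₁ :=
    Metric.ball_subset_ball (by linarith)
  refine ⟨p '' Metric.ball 0 (R₁ / 4), (hop _ (fun z hz ↦ (hball z (hsub hz)).2)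
    Metric.isOpen_ball).mem_nhds ⟨0, Metric.mem_ball_self (by linarith), hp0⟩, ?_⟩
  rintro s hs N hN _ ⟨z, hz, rfl⟩
  have hnorm : ∀ z ∈ Metric.ball (0 : Cn n) R₁,
      (h.form (p z) (s (p z)) (s (p z))).re = ‖c s z‖ ^ 2 * w z := by
    intro z hz
    rw [hform s s z (hball z hz).2, re_conj_mul_self_mul]
  have hN0 : 0 ≤ N := (h.form_self_re_nonneg _).trans (hN x)
  have hcs0 : c s 0 = 0 := by
    have h1 := hnorm 0 (Metric.mem_ball_self hR₁)
    rw [hp0, hs] at h1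
    simpa [hw0.ne'] using h1
  have hbound : ∀ z ∈ Metric.ball (0 : Cn n) R₁, ‖c s z‖ ≤ √(2 * N / w 0) := by
    intro z hz
    apply Real.le_sqrt_of_sq_le
    have h1 := hN (p z)
    rw [hnorm z hz] at h1
    have h2 := (hball z hz).1.1
    rw [le_div_iff₀ hw0]
    nlinarith [sq_nonneg ‖c s z‖]
  have hschwarz := Complex.dist_le_div_mul_dist_of_mapsTo_ball (f := c s) (c := 0) (z := z)
    (R₁ := R₁) (R₂ := √(2 * N / w 0))
    (fun y hy ↦ ((hc s) y (hball y hy).2).differentiableAt.differentiableWithinAt)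
    (fun y hy ↦ by simpa [hcs0] using hbound y hy) (hsub hz)
  rw [hcs0, dist_zero_right, dist_zero_right] at hschwarz
  have hz4 : ‖z‖ ≤ R₁ / 4 := by simpa using (mem_ball_zero_iff.1 hz).le
  have h3 : ‖c s z‖ ≤ √(2 * N / w 0) / 4 := by
    refine hschwarz.trans ?_
    calc √(2 * N / w 0) / R₁ * ‖z‖ ≤ √(2 * N / w 0) / R₁ * (R₁ / 4) := by gcongr
      _ = √(2 * N / w 0) / 4 := by field_simp
  have h4 : ‖c s z‖ ^ 2 ≤ 2 * N / w 0 / 16 := by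
    calc ‖c s z‖ ^ 2 ≤ (√(2 * N / w 0) / 4) ^ 2 := by gcongr
      _ = 2 * N / w 0 / 16 := by rw [div_pow, Real.sq_sqrt (by positivity)]; norm_num
  rw [hnorm z (hsub hz)]
  calc ‖c s z‖ ^ 2 * w z ≤ 2 * N / w 0 / 16 * (2 * w 0) := by
        gcongr
        · exact (hw z (hball z (hsub hz)).2).le
        · exact (hball z (hsub hz)).1.2.le
    _ = N / 4 := by field_simp; ring
    _ ≤ N / 2 := by linarith

/-- Evaluation at the centres of a finite subcover is injective: if `s` vanishes at all of them, the
maximum of its squared norm is at most half of itself, hence zero. -/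
theorem finiteDimensional_holSection [CompactSpace M] (h : HermitianMetric n L) :
    FiniteDimensional ℂ (HolSection n L) := by
  choose W hW hhalf using exists_nhds_norm_sq_le_half (L := L) h
  obtain ⟨F, hF⟩ := isCompact_univ.elim_nhds_subcover W fun x _ ↦ hW x
  let ev : HolSection n L →ₗ[ℂ] (F → ℂ) :=
    { toFun := fun s x ↦ (trivializationAt ℂ L x.1).linearMapAt ℂ x.1 (s x.1)
      map_add' := fun s t ↦ by ext; simp
      map_smul' := fun a s ↦ by ext; simp }
  refine FiniteDimensional.of_injective ev ((injective_iff_map_eq_zero ev).2 fun s hs ↦ ?_)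
  have hsF : ∀ x ∈ F, s x = 0 := by
    intro x hx
    have h1 := congrFun hs ⟨x, hx⟩
    rw [eq_smul_localFrame (trivializationAt ℂ L x)
      (FiberBundle.mem_baseSet_trivializationAt' x) (s x)]
    change (trivializationAt ℂ L x).linearMapAt ℂ x (s x) = 0 at h1
    rw [h1, zero_smul]
  ext x
  have hcont : Continuous fun y ↦ (h.form y (s y) (s y)).re :=
    Complex.continuous_re.comp (contMDiff_form h s s).continuous
  obtain ⟨y, -, hy⟩ := isCompact_univ.exists_isMaxOn ⟨x, Set.mem_univ x⟩ hcont.continuousOn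
  have hmax : ∀ z, (h.form z (s z) (s z)).re ≤ (h.form y (s y) (s y)).re :=
    fun z ↦ hy (Set.mem_univ z)
  obtain ⟨x', hx', hyx'⟩ := Set.mem_iUnion₂.1 (hF.2 (Set.mem_univ y))
  have h1 := hhalf x' s (hsF x' hx') _ hmax y hyx'
  have h2 := hmax x
  by_contra hne
  have h3 := h.pos x (s x) hne
  linarith

/-- The identity theorem for holomorphic sections. -/
theorem holSection_eq_zero_of_eventually [PreconnectedSpace M] (h : HermitianMetric n L)
    (s : HolSection n L) {x : M} (hs : ∀ᶠ y in nhds x, s y = 0) : s = 0 := by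
  set Z : Set M := {x | ∀ᶠ y in nhds x, s y = 0}
  have hZo : IsOpen Z := isOpen_setOfPred_eventually_nhds
  have hZc : IsClosed Z := by
    rw [← closure_subset_iff_isClosed]
    intro y hy
    obtain ⟨R, p, c, w, hR, hp0, hop, hpc, hc, -, hw, hform⟩ := exists_local_model h y
    have hN : p '' Metric.ball 0 R ∈ nhds y :=
      (hop _ subset_rfl Metric.isOpen_ball).mem_nhds ⟨0, Metric.mem_ball_self hR, hp0⟩
    -- A point of `Z` inside the coordinate ball at `y` lets the vanishing spread over the whole
    -- ball, so `y` is in `Z`.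
    obtain ⟨_, ⟨a, ha, rfl⟩, haZ⟩ := mem_closure_iff_nhds.1 hy _ hN
    have hac : ContinuousAt p a := hpc.continuousAt (Metric.isOpen_ball.mem_nhds ha)
    have hcz : c s =ᶠ[nhds a] 0 := by
      filter_upwards [hac.eventually haZ, Metric.isOpen_ball.mem_nhds ha] with z hz hzR
      have h1 := hform s s z hzR
      rw [hz] at h1
      simpa [(hw z hzR).ne'] using h1
    have hc0 := (hc s).eqOn_zero_of_preconnected_of_eventuallyEq_zero
      (convex_ball _ _).isPreconnected ha hcz
    filter_upwards [hN]
    rintro _ ⟨z, hz, rfl⟩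
    rw [← h.form_self_eq_zero, hform s s z hz, hc0 hz]
    simp
  have hZ : Z = Set.univ := IsClopen.eq_univ ⟨hZc, hZo⟩ ⟨x, hs⟩
  ext y
  have : y ∈ Z := hZ ▸ Set.mem_univ y
  exact this.self_of_nhds

/-- The functions `h(bᵢ, bⱼ)` are linearly independent if the holomorphic sections `bᵢ` are. -/
theorem coeff_eq_zero_of_sum_form_eq_zero [PreconnectedSpace M]
    (h : HermitianMetric n L) {ι : Type*} [Fintype ι] {b : ι → HolSection n L}
    (hb : LinearIndependent ℂ b) (c : ι → ι → ℂ)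
    (h0 : ∀ x, ∑ i, ∑ j, c i j * h.form x (b i x) (b j x) = 0) (i j : ι) : c i j = 0 := by
  have hsum : ∀ (a : ι → ℂ) (x : M), (∑ i, a i • b i) x = ∑ i, a i • b i x := by
    intro a x
    have := map_sum (ContMDiffSection.coeAddHom 𝓘(ℂ, Cn n) ℂ ω L) (fun i ↦ a i • b i) Finset.univ
    exact (congrFun this x).trans (Finset.sum_apply _ _ _)
  -- Freezing the conjugated variable at `x` gives a holomorphic section that vanishes near `x`,
  -- hence everywhere. Independence makes its `j`-th coefficient zero, which is the conjugate of
  -- this identity in the frame. As `x` varies, independence applies a second time.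
  have key : ∀ x, ∑ i, starRingEnd ℂ (c i j) • b i x = 0 := by
    intro x
    obtain ⟨R, p, C, w, hR, hp0, hop, hpc, hC, -, hw, hform⟩ := exists_local_model h x
    have h0R : (0 : Cn n) ∈ Metric.ball (0 : Cn n) R := Metric.mem_ball_self hR
    have hdiag : ∀ z ∈ Metric.ball (0 : Cn n) R,
        ∑ i, ∑ j, c i j * (starRingEnd ℂ (C (b i) z) * C (b j) z) = 0 := by
      intro z hz
      have h1 := h0 (p z)
      simp only [hform _ _ z hz, ← mul_assoc, ← Finset.sum_mul] at h1
      simpa [(hw z hz).ne', mul_assoc] using h1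
    have hpol : ∀ z ∈ Metric.ball (0 : Cn n) R,
        C (∑ j, (∑ i, c i j * starRingEnd ℂ (C (b i) 0)) • b j) z = 0 := by
      intro z hz
      have h1 := sum_conj_mul_eq_zero_of_diagonal_ball c (fun i ↦ C (b i))
        (fun i ↦ (hC (b i)).differentiableOn) hdiag hz
      rw [Finset.sum_comm] at h1
      simpa [Finset.sum_apply, Finset.sum_mul, mul_assoc] using h1
    have hS : ∑ j, (∑ i, c i j * starRingEnd ℂ (C (b i) 0)) • b j = 0 := by
      refine holSection_eq_zero_of_eventually h _ (x := x) ?_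
      filter_upwards [(hop _ subset_rfl Metric.isOpen_ball).mem_nhds
        ⟨0, Metric.mem_ball_self hR, hp0⟩]
      rintro _ ⟨z, hz, rfl⟩
      rw [← h.form_self_eq_zero, hform _ _ z hz, hpol z hz]
      simp
    have hj := Fintype.linearIndependent_iff.1 hb _ hS j
    have hT : C (∑ i, starRingEnd ℂ (c i j) • b i) 0 = 0 := by
      have h1 := congrArg (starRingEnd ℂ) hj
      simpa [Finset.sum_apply] using h1
    rw [← hsum, ← h.form_self_eq_zero]
    conv_lhs => rw [← hp0]
    rw [hform _ _ 0 h0R, hT]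
    simp
  have hT : ∑ i, starRingEnd ℂ (c i j) • b i = 0 := by
    ext x
    rw [hsum, key]
    rfl
  simpa using Fintype.linearIndependent_iff.1 hb _ hT i

end Global

/-! ### Orthonormal bases of positive definite hermitian forms. -/

section HermitianForm

variable {V : Type*} [AddCommGroup V] [Module ℂ V]

/-- The inner product space structure given by a positive definite hermitian form. -/
abbrev coreOfForm (B : V →ₗ⋆[ℂ] V →ₗ[ℂ] ℂ) (hB : ∀ u v, starRingEnd ℂ (B u v) = B v u)
    (hpos : ∀ u, u ≠ 0 → 0 < (B u u).re) : InnerProductSpace.Core ℂ V where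
  inner u v := B u v
  conj_inner_symm u v := hB v u
  re_inner_nonneg u := by
    by_cases hu : u = 0
    · simp [hu]
    · exact (hpos u hu).le
  add_left u v w := by simp
  smul_left u v a := by simp
  definite u hu := by
    by_contra hne
    have := hpos u hne
    simp [hu] at this

variable [FiniteDimensional ℂ V]

/-- The inner product structure lives only inside the proof, so no norm is imposed on `V`. It serves
both the scalar product of sections and the hermitian form of a Kähler form on `ℂⁿ`. -/
theorem exists_basis_orthonormal (B : V →ₗ⋆[ℂ] V →ₗ[ℂ] ℂ)
    (hB : ∀ u v, starRingEnd ℂ (B u v) = B v u) (hpos : ∀ u, u ≠ 0 → 0 < (B u u).re) {d : ℕ}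
    (hd : Module.finrank ℂ V = d) :
    ∃ b : Module.Basis (Fin d) ℂ V, ∀ i j, B (b i) (b j) = if i = j then 1 else 0 := by
  let := coreOfForm B hB hpos
  let : NormedAddCommGroup V := InnerProductSpace.Core.toNormedAddCommGroup (𝕜 := ℂ)
  let : InnerProductSpace ℂ V := InnerProductSpace.ofCore _
  let b := (stdOrthonormalBasis ℂ V).reindex (finCongr hd)
  refine ⟨b.toBasis, fun i j ↦ ?_⟩
  have := orthonormal_iff_ite.1 b.orthonormal i j
  rw [b.coe_toBasis]
  exact this

end HermitianForm

/-! ### The top exterior power of a 2-form. -/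

section Wedge

variable {n : ℕ} {V : Type*} [AddCommGroup V] [Module ℝ V] [TopologicalSpace V]

theorem prod_update_eq [DecidableEq (Fin n × Fin 2)] (β : V [⋀^Fin 2]→L[ℝ] ℝ)
    (v : Fin n × Fin 2 → V) (i₀ : Fin n) (k : Fin 2) (z : V) :
    ∏ i : Fin n, β (fun l ↦ Function.update v (i₀, k) z (i, l)) =
      β (Function.update (fun l ↦ v (i₀, l)) k z) *
        ∏ i ∈ Finset.univ.erase i₀, β fun l ↦ v (i, l) := by
  have heq : (fun l ↦ Function.update v (i₀, k) z (i₀, l)) =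
      Function.update (fun l ↦ v (i₀, l)) k z := by
    ext l
    by_cases h : l = k <;> simp [h]
  rw [← Finset.mul_prod_erase _ _ (Finset.mem_univ i₀), heq]
  congr 1
  refine Finset.prod_congr rfl fun i hi ↦ ?_
  congr 1
  ext l
  rw [Function.update_of_ne (by simp [Finset.ne_of_mem_erase hi])]

/-- The multilinear form `v ↦ ∏ᵢ β(v (i, 0), v (i, 1))`. -/
def prodForm (n : ℕ) (β : V [⋀^Fin 2]→L[ℝ] ℝ) :
    MultilinearMap ℝ (fun _ : Fin n × Fin 2 ↦ V) ℝ where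
  toFun v := ∏ i : Fin n, β fun k ↦ v (i, k)
  map_update_add' v p x y := by
    rw [prod_update_eq, prod_update_eq, prod_update_eq, β.map_update_add, add_mul]
  map_update_smul' v p a x := by
    rw [prod_update_eq, prod_update_eq, β.map_update_smul, smul_mul_assoc]

/-- Recognizing an alternatization makes the uniqueness of top-degree alternating forms available.
-/
theorem wedgePowDivFactorial_eq (β : V [⋀^Fin 2]→L[ℝ] ℝ) (v : Fin n × Fin 2 → V) :
    wedgePowDivFactorial β v =
      (1 / ((n.factorial : ℝ) * 2 ^ n)) * (prodForm n β).alternatization v := by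
  rw [wedgePowDivFactorial, MultilinearMap.alternatization_apply]
  congr 1
  refine Finset.sum_congr rfl fun σ _ ↦ ?_
  rw [Units.smul_def, zsmul_eq_mul, MultilinearMap.domDomCongr_apply]
  congr 1
  refine Finset.prod_congr rfl fun i _ ↦ ?_
  congr 1
  ext k
  fin_cases k <;> rfl

/-- `(2n)`-forms are proportional to the determinant in a basis. -/
theorem wedgePowDivFactorial_basis (β : V [⋀^Fin 2]→L[ℝ] ℝ)
    (b : Module.Basis (Fin n × Fin 2) ℝ V) (v : Fin n × Fin 2 → V) :
    wedgePowDivFactorial β v = b.det v * wedgePowDivFactorial β b := by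
  rw [wedgePowDivFactorial_eq, wedgePowDivFactorial_eq]
  conv_lhs => rw [(prodForm n β).alternatization.eq_smul_basis_det b]
  simp only [AlternatingMap.smul_apply, smul_eq_mul]
  ring

theorem wedgePowDivFactorial_comp (β : V [⋀^Fin 2]→L[ℝ] ℝ)
    (b : Module.Basis (Fin n × Fin 2) ℝ V) (A : V →L[ℝ] V) :
    wedgePowDivFactorial (β.compContinuousLinearMap A) b =
      LinearMap.det (A : V →ₗ[ℝ] V) * wedgePowDivFactorial β b := by
  have h1 : wedgePowDivFactorial (β.compContinuousLinearMap A) b =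
      wedgePowDivFactorial β ((A : V →ₗ[ℝ] V) ∘ b) := by
    simp only [wedgePowDivFactorial]
    congr 1
    refine Finset.sum_congr rfl fun σ _ ↦ ?_
    congr 1
    refine Finset.prod_congr rfl fun i _ ↦ ?_
    rw [ContinuousAlternatingMap.compContinuousLinearMap_apply]
    congr 1
    ext k
    fin_cases k <;> rfl
  rw [h1, wedgePowDivFactorial_basis β b, Module.Basis.det_comp, Module.Basis.det_self, mul_one]

/-- A permutation of `Fin n × Fin 2` which maps pairs `{(i, 0), (i, 1)}` to pairs. -/
theorem exists_decomposition_of_fst_eq (σ : Equiv.Perm (Fin n × Fin 2))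
    (h : ∀ i, (σ (i, 0)).1 = (σ (i, 1)).1) :
    ∃ (τ : Equiv.Perm (Fin n)) (ρ : Fin n → Equiv.Perm (Fin 2)),
      ∀ i k, σ (i, k) = (τ i, ρ i k) := by
  have hk : ∀ i k, (σ (i, k)).1 = (σ (i, 0)).1 := by
    intro i k
    fin_cases k
    · rfl
    · exact (h i).symm
  have hρ : ∀ i, Function.Injective fun k ↦ (σ (i, k)).2 := by
    intro i k l hkl
    have : σ (i, k) = σ (i, l) := Prod.ext ((hk i k).trans (hk i l).symm) hkl
    exact (Prod.ext_iff.1 (σ.injective this)).2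
  have hτ : Function.Injective fun i ↦ (σ (i, 0)).1 := by
    intro i j hij
    -- The second coordinates on the pair `i` exhaust `Fin 2`, so two pairs with the same image pair
    -- would share an image point.
    obtain ⟨k, hk'⟩ := (Finite.injective_iff_surjective.1 (hρ i)) (σ (j, 0)).2
    have : σ (i, k) = σ (j, 0) := Prod.ext ((hk i k).trans hij) hk'
    exact (Prod.ext_iff.1 (σ.injective this)).1
  exact ⟨Equiv.ofBijective _ (Finite.injective_iff_bijective.1 hτ),
    fun i ↦ Equiv.ofBijective _ (Finite.injective_iff_bijective.1 (hρ i)),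
    fun i k ↦ Prod.ext (hk i k) rfl⟩

/-- `τ` acts on both columns at once, so its sign enters squared and drops out. -/
theorem sign_eq_prod_of_decomposition (σ : Equiv.Perm (Fin n × Fin 2)) (τ : Equiv.Perm (Fin n))
    (ρ : Fin n → Equiv.Perm (Fin 2)) (h : ∀ i k, σ (i, k) = (τ i, ρ i k)) :
    Equiv.Perm.sign σ = ∏ i, Equiv.Perm.sign (ρ i) := by
  have hσ : σ = Equiv.prodCongrLeft (fun _ : Fin 2 ↦ τ) * Equiv.prodCongrRight ρ := by
    ext1 ⟨i, k⟩
    rw [h]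
    rfl
  rw [hσ, map_mul, Equiv.Perm.sign_prodCongrLeft, Equiv.Perm.sign_prodCongrRight]
  simp

/-- The top power of a 2-form is positive on a symplectic basis. -/
theorem wedgePowDivFactorial_pos_of_symplectic (β : V [⋀^Fin 2]→L[ℝ] ℝ) (v : Fin n × Fin 2 → V)
    (hv : ∀ i j k l, β ![v (i, k), v (j, l)] =
      if i = j then ((l : ℕ) : ℝ) - ((k : ℕ) : ℝ) else 0) :
    0 < wedgePowDivFactorial β v := by
  rw [wedgePowDivFactorial]
  refine mul_pos (by positivity) ?_
  -- A swap within a pair changes the sign of `σ` and that of one factor `β`, so every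
  -- pair-preserving permutation contributes `1`; all others contribute `0`.
  have hone : ∀ σ : Equiv.Perm (Fin n × Fin 2), (∀ i, (σ (i, 0)).1 = (σ (i, 1)).1) →
      ((Equiv.Perm.sign σ : ℤ) : ℝ) * ∏ i : Fin n, β ![v (σ (i, 0)), v (σ (i, 1))] = 1 := by
    intro σ hσ
    obtain ⟨τ, ρ, hτρ⟩ := exists_decomposition_of_fst_eq σ hσ
    rw [sign_eq_prod_of_decomposition σ τ ρ hτρ]
    push_cast
    rw [← Finset.prod_mul_distrib]
    refine Finset.prod_eq_one fun i _ ↦ ?_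
    rw [hτρ, hτρ, hv, if_pos rfl]
    have : ∀ g : Equiv.Perm (Fin 2),
        (Equiv.Perm.sign g : ℤ) * (((g 1 : ℕ) : ℤ) - ((g 0 : ℕ) : ℤ)) = 1 := by decide
    exact_mod_cast this (ρ i)
  refine Finset.sum_pos' (fun σ _ ↦ ?_) ⟨1, Finset.mem_univ _, ?_⟩
  · by_cases hσ : ∀ i, (σ (i, 0)).1 = (σ (i, 1)).1
    · rw [hone σ hσ]
      exact zero_le_one
    · push Not at hσ
      obtain ⟨i, hi⟩ := hσ
      rw [Finset.prod_eq_zero (Finset.mem_univ i), mul_zero]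
      have := hv (σ (i, 0)).1 (σ (i, 1)).1 (σ (i, 0)).2 (σ (i, 1)).2
      rwa [if_neg hi] at this
  · rw [hone 1 fun _ ↦ rfl]
    exact one_pos

/-- `realBasis` as a basis. -/
def realBasisBasis (n : ℕ) : Module.Basis (Fin n × Fin 2) ℝ (Cn n) :=
  (Complex.basisOneI.smulTower (EuclideanSpace.basisFun (Fin n) ℂ).toBasis).reindex
    (Equiv.prodComm _ _)

theorem coe_realBasisBasis (n : ℕ) : ⇑(realBasisBasis n) = realBasis n := by
  ext1 ⟨i, k⟩
  fin_cases k <;> simp [realBasisBasis, realBasis, Module.Basis.smulTower_apply]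

/-- `β(u, iv) + i β(u, v)` is a positive definite hermitian form. An orthonormal basis for it,
together with its multiples by `i`, is symplectic for `β`, and there the top power is positive.
Passing to the standard basis divides by a determinant; its sign does not matter, since the density
is an absolute value. -/
theorem wedgePowDivFactorial_ne_zero (β : Cn n [⋀^Fin 2]→L[ℝ] ℝ)
    (h11 : ∀ u v : Cn n, β ![Complex.I • u, Complex.I • v] = β ![u, v])
    (hpos : ∀ u : Cn n, u ≠ 0 → 0 < β ![u, Complex.I • u]) :
    wedgePowDivFactorial β (realBasis n) ≠ 0 := by
  have hadd : ∀ u v w, β ![u + v, w] = β ![u, w] + β ![v, w] := fun u v w ↦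
    β.map_vecCons_add ![w] u v
  have hsmul : ∀ (a : ℝ) u w, β ![a • u, w] = a * β ![u, w] := fun a u w ↦
    β.map_vecCons_smul ![w] a u
  have hswap : ∀ u v, β ![u, v] = -β ![v, u] := by
    intro u v
    have := β.toAlternatingMap.map_swap ![u, v] (i := 0) (j := 1) (by simp)
    have h2 : ![u, v] ∘ Equiv.swap (0 : Fin 2) 1 = ![v, u] := by
      ext1 k
      fin_cases k <;> simp
    rw [h2] at this
    change β ![v, u] = -β ![u, v] at this
    linarith
  have hadd' : ∀ u v w, β ![w, u + v] = β ![w, u] + β ![w, v] := fun u v w ↦ by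
    rw [hswap, hadd, hswap u, hswap v]; ring
  have hsmul' : ∀ (a : ℝ) u w, β ![w, a • u] = a * β ![w, u] := fun a u w ↦ by
    rw [hswap, hsmul, hswap u]; ring
  have hI : ∀ u v, β ![Complex.I • u, v] = -β ![u, Complex.I • v] := fun u v ↦ by
    rw [← h11 u, smul_smul, Complex.I_mul_I]
    have := hsmul' (-1) v (Complex.I • u)
    rw [neg_one_smul] at this
    rw [neg_one_smul, this]; ring
  have hII : ∀ u v, β ![u, Complex.I • Complex.I • v] = -β ![u, v] := fun u v ↦ by
    have := hsmul' (-1) v u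
    rw [smul_smul, Complex.I_mul_I]
    rw [neg_one_smul] at this ⊢
    rw [this]; ring
  have hdecomp : ∀ (a : ℂ) (u : Cn n), a • u = a.re • u + a.im • Complex.I • u := by
    intro a u
    conv_lhs => rw [← Complex.re_add_im a, add_smul, mul_smul]
    rfl
  let B : Cn n →ₗ⋆[ℂ] Cn n →ₗ[ℂ] ℂ := LinearMap.mk₂'ₛₗ (starRingEnd ℂ) (RingHom.id ℂ)
    (fun u v ↦ (β ![u, Complex.I • v] : ℂ) + Complex.I * (β ![u, v] : ℂ))
    (fun u v w ↦ by simp only [hadd]; push_cast; ring)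
    (fun a u v ↦ by
      simp only [hdecomp a u, hadd, hsmul, hI, hII]
      apply Complex.ext <;> simp)
    (fun u v w ↦ by simp only [smul_add, hadd']; push_cast; ring)
    (fun a u v ↦ by
      have h1 : Complex.I • a.re • v = a.re • Complex.I • v := smul_comm _ _ _
      have h2 : Complex.I • a.im • Complex.I • v = a.im • Complex.I • Complex.I • v :=
        smul_comm _ _ _
      simp only [hdecomp a v, smul_add, h1, h2, hadd', hsmul', hII]
      apply Complex.ext <;> simp; ring)
  have hBre : ∀ u v, (B u v).re = β ![u, Complex.I • v] := fun u v ↦ by simp [B]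
  have hBim : ∀ u v, (B u v).im = β ![u, v] := fun u v ↦ by simp [B]
  obtain ⟨b, hb⟩ := exists_basis_orthonormal B
    (fun u v ↦ by
      apply Complex.ext
      · rw [Complex.conj_re, hBre, hBre, hswap v, hI]; ring
      · rw [Complex.conj_im, hBim, hBim, hswap v])
    (fun u hu ↦ by rw [hBre]; exact hpos u hu) (d := n) (by simp)
  have him : ∀ i j, β ![b i, b j] = 0 := fun i j ↦ by
    rw [← hBim, hb]
    split_ifs <;> simp
  have hre : ∀ i j, β ![b i, Complex.I • b j] = if i = j then 1 else 0 := fun i j ↦ by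
    rw [← hBre, hb]
    split_ifs <;> simp
  have hsymp := wedgePowDivFactorial_pos_of_symplectic β
    (fun p : Fin n × Fin 2 ↦ if p.2 = 0 then b p.1 else Complex.I • b p.1) (by
      intro i j k l
      fin_cases k <;> fin_cases l <;> simp [him, hre, h11, hI]
      split_ifs <;> simp)
  rw [wedgePowDivFactorial_basis β (realBasisBasis n), coe_realBasisBasis] at hsymp
  exact (right_ne_zero_of_mul hsymp.ne')

end Wedge

/-! ### The Liouville measure: compatibility of charts, positivity and finiteness. -/

section Measure

variable {n : ℕ} {M : Type*} [TopologicalSpace M] [ChartedSpace (Cn n) M]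

/-- The transformation rule of 2-forms under a change of charts. -/
theorem formInChart_eq_comp [IsManifold 𝓘(ℂ, Cn n) ω M] (κ : TwoForm n M)
    {φ φ' : OpenPartialHomeomorph M (Cn n)}
    (hφ : φ ∈ atlas (Cn n) M) (hφ' : φ' ∈ atlas (Cn n) M) {z : Cn n} (hz : z ∈ φ.target)
    (hz' : φ.symm z ∈ φ'.source) :
    ∃ A : Cn n →L[ℝ] Cn n, HasFDerivAt (φ' ∘ φ.symm) A z ∧
      formInChart κ φ z = (formInChart κ φ' (φ' (φ.symm z))).compContinuousLinearMap A := by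
  have := isManifold_real (n := n) (M := M) 1
  have hd : MDifferentiableAt 𝓘(ℝ, Cn n) 𝓘(ℝ, Cn n) φ.symm z :=
    mdifferentiableAt_atlas_symm hφ hz
  have hd₁ : MDifferentiableAt 𝓘(ℝ, Cn n) 𝓘(ℝ, Cn n) φ' (φ.symm z) :=
    mdifferentiableAt_atlas hφ' hz'
  have hd₂ : MDifferentiableAt 𝓘(ℝ, Cn n) 𝓘(ℝ, Cn n) φ'.symm (φ' (φ.symm z)) :=
    mdifferentiableAt_atlas_symm hφ' (φ'.map_source hz')
  have hT : MDifferentiableAt 𝓘(ℝ, Cn n) 𝓘(ℝ, Cn n) (φ' ∘ φ.symm) z := hd₁.comp z hd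
  refine ⟨fderiv ℝ (φ' ∘ φ.symm) z,
    (mdifferentiableAt_iff_differentiableAt.1 hT).hasFDerivAt, ?_⟩
  have heq : φ'.symm ∘ (φ' ∘ φ.symm) =ᶠ[nhds z] φ.symm := by
    have hn : φ.symm ⁻¹' φ'.source ∈ nhds z :=
      (φ.continuousAt_symm hz).preimage_mem_nhds (φ'.open_source.mem_nhds hz')
    filter_upwards [hn] with y hy using φ'.left_inv hy
  have hcomp : mfderiv 𝓘(ℝ, Cn n) 𝓘(ℝ, Cn n) (φ'.symm ∘ (φ' ∘ φ.symm)) z =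
      (mfderiv 𝓘(ℝ, Cn n) 𝓘(ℝ, Cn n) φ'.symm (φ' (φ.symm z))).comp
        (mfderiv 𝓘(ℝ, Cn n) 𝓘(ℝ, Cn n) (φ' ∘ φ.symm) z) :=
    mfderiv_comp z hd₂ hT
  have hm : ∀ u : Cn n, (mfderiv 𝓘(ℝ, Cn n) 𝓘(ℝ, Cn n) φ.symm z : Cn n → Cn n) u =
      (mfderiv 𝓘(ℝ, Cn n) 𝓘(ℝ, Cn n) φ'.symm (φ' (φ.symm z)) : Cn n → Cn n)
        (fderiv ℝ (φ' ∘ φ.symm) z u) := by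
    intro u
    have h1 := heq.mfderiv_eq (I := 𝓘(ℝ, Cn n)) (I' := 𝓘(ℝ, Cn n))
    rw [← mfderiv_eq_fderiv]
    exact congrArg (fun D : Cn n →L[ℝ] Cn n ↦ D u) (h1.symm.trans hcomp)
  ext v
  -- Forgetting that the tangent space depends on the point allows the base point to be rewritten.
  let κ' : M → Cn n [⋀^Fin 2]→L[ℝ] ℝ := κ
  change κ' (φ.symm z) (fun i ↦ (mfderiv 𝓘(ℝ, Cn n) 𝓘(ℝ, Cn n) φ.symm z : Cn n → Cn n) (v i)) =
    κ' (φ'.symm (φ' (φ.symm z))) (fun i ↦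
      (mfderiv 𝓘(ℝ, Cn n) 𝓘(ℝ, Cn n) φ'.symm (φ' (φ.symm z)) : Cn n → Cn n)
        (fderiv ℝ (φ' ∘ φ.symm) z (v i)))
  rw [φ'.left_inv hz']
  congr 1
  ext1 i
  exact hm (v i)

/-- Pulling back a top form multiplies it by the determinant, whose absolute value is the Jacobian
factor in the change of variables formula. -/
theorem exists_hasFDerivAt_liouvilleDensity [IsManifold 𝓘(ℂ, Cn n) ω M] (κ : TwoForm n M)
    {φ φ' : OpenPartialHomeomorph M (Cn n)}
    (hφ : φ ∈ atlas (Cn n) M) (hφ' : φ' ∈ atlas (Cn n) M) {z : Cn n} (hz : z ∈ φ.target)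
    (hz' : φ.symm z ∈ φ'.source) :
    ∃ A : Cn n →L[ℝ] Cn n, HasFDerivAt (φ' ∘ φ.symm) A z ∧
      liouvilleDensity κ φ z = |A.det| * liouvilleDensity κ φ' (φ' (φ.symm z)) := by
  obtain ⟨A, hA, hform⟩ := formInChart_eq_comp κ hφ hφ' hz hz'
  refine ⟨A, hA, ?_⟩
  rw [liouvilleDensity, liouvilleDensity, hform, ← coe_realBasisBasis,
    wedgePowDivFactorial_comp, abs_mul]

theorem IsKahlerForm.continuousOn_liouvilleDensity {κ : TwoForm n M} (hκ : IsKahlerForm κ)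
    {φ : OpenPartialHomeomorph M (Cn n)} (hφ : φ ∈ atlas (Cn n) M) :
    ContinuousOn (liouvilleDensity κ φ) φ.target := by
  have hc := (hκ.smooth φ hφ).continuousOn
  have hev : ∀ u : Fin 2 → Cn n, ContinuousOn (fun z ↦ formInChart κ φ z u) φ.target :=
    fun u ↦ (continuous_eval_const u).comp_continuousOn hc
  refine (ContinuousOn.mul continuousOn_const ?_).abs
  exact continuousOn_finsetSum _ fun σ _ ↦ ContinuousOn.mul continuousOn_const
    (continuousOn_finsetProd _ fun i _ ↦ hev _)

theorem IsKahlerForm.liouvilleDensity_pos {κ : TwoForm n M} (hκ : IsKahlerForm κ)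
    {φ : OpenPartialHomeomorph M (Cn n)} (hφ : φ ∈ atlas (Cn n) M) {z : Cn n}
    (hz : z ∈ φ.target) : 0 < liouvilleDensity κ φ z :=
  abs_pos.2 (wedgePowDivFactorial_ne_zero _ (hκ.type_one_one φ hφ z hz) (hκ.pos φ hφ z hz))

variable [MeasurableSpace M] [BorelSpace M]

theorem chartVolume_apply (κ : TwoForm n M) (φ : OpenPartialHomeomorph M (Cn n)) {S : Set M}
    (hS : MeasurableSet S) :
    chartVolume κ φ S =
      ∫⁻ z in φ.target ∩ φ.symm ⁻¹' S, ENNReal.ofReal (liouvilleDensity κ φ z) := by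
  have hm : AEMeasurable φ.symm ((volume : Measure (Cn n)).restrict φ.target) :=
    φ.continuousOn_symm.aemeasurable φ.open_target.measurableSet
  rw [chartVolume, Measure.map_apply_of_aemeasurable
    (hm.mono_ac (withDensity_absolutelyContinuous _ _)) hS, withDensity_apply',
    Measure.restrict_restrict' φ.open_target.measurableSet, Set.inter_comm]

theorem chartVolume_inter_source (κ : TwoForm n M) (φ : OpenPartialHomeomorph M (Cn n)) {S : Set M}
    (hS : MeasurableSet S) : chartVolume κ φ (S ∩ φ.source) = chartVolume κ φ S := by
  rw [chartVolume_apply κ φ hS, chartVolume_apply κ φ (hS.inter φ.open_source.measurableSet)]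
  congr 2
  ext z
  simp only [Set.mem_inter_iff, Set.mem_preimage]
  exact ⟨fun h ↦ ⟨h.1, h.2.1⟩, fun h ↦ ⟨h.1, h.2, φ.map_target h.1⟩⟩

/-- The measures defined in two charts agree on the overlap. -/
theorem chartVolume_eq_of_subset [IsManifold 𝓘(ℂ, Cn n) ω M] (κ : TwoForm n M)
    {φ φ' : OpenPartialHomeomorph M (Cn n)}
    (hφ : φ ∈ atlas (Cn n) M) (hφ' : φ' ∈ atlas (Cn n) M) {S : Set M} (hS : MeasurableSet S)
    (hSφ : S ⊆ φ.source) (hSφ' : S ⊆ φ'.source) : chartVolume κ φ S = chartVolume κ φ' S := by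
  rw [chartVolume_apply κ φ hS, chartVolume_apply κ φ' hS]
  have himage : φ'.target ∩ φ'.symm ⁻¹' S = (φ' ∘ φ.symm) '' (φ.target ∩ φ.symm ⁻¹' S) := by
    ext y
    constructor
    · rintro ⟨hy, hyS⟩
      refine ⟨φ (φ'.symm y), ⟨φ.map_source (hSφ hyS), ?_⟩, ?_⟩
      · simpa [φ.left_inv (hSφ hyS)] using hyS
      · simp [φ.left_inv (hSφ hyS), φ'.right_inv hy]
    · rintro ⟨z, ⟨hz, hzS⟩, rfl⟩
      refine ⟨φ'.map_source (hSφ' hzS), ?_⟩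
      simpa [φ'.left_inv (hSφ' hzS)] using hzS
  -- `φ.symm` is continuous only on the target; replacing it by a constant elsewhere gives a
  -- measurable map without changing the set.
  have hmeas : MeasurableSet (φ.target ∩ φ.symm ⁻¹' S) := by
    classical
    have hm := φ.continuousOn_symm.measurable_piecewise
      (continuousOn_const (c := φ.symm 0) (s := φ.targetᶜ)) φ.open_target.measurableSet
    have := φ.open_target.measurableSet.inter (hm hS)
    convert this using 1
    ext z
    simp only [Set.mem_inter_iff, Set.mem_preimage]
    exact and_congr_right fun hz ↦ by rw [Set.piecewise_eq_of_mem _ _ _ hz]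
  choose! A hA hdens using fun z (hz : z ∈ φ.target ∩ φ.symm ⁻¹' S) ↦
    exists_hasFDerivAt_liouvilleDensity κ hφ hφ' hz.1 (hSφ' hz.2)
  rw [himage, lintegral_image_eq_lintegral_abs_det_fderiv_mul volume hmeas
    (fun z hz ↦ (hA z hz).hasFDerivWithinAt)]
  · refine setLIntegral_congr_fun hmeas fun z hz ↦ ?_
    rw [hdens z hz, ENNReal.ofReal_mul (abs_nonneg _)]
    rfl
  · intro z hz y hy hzy
    exact φ.symm.injOn hz.1 hy.1 (φ'.injOn (hSφ' hz.2) (hSφ' hy.2) hzy)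

/-- A single chart volume, whose density is positive on the chart, already bounds the supremum from
below. -/
theorem IsKahlerForm.isOpenPosMeasure {κ : TwoForm n M} (hκ : IsKahlerForm κ) :
    (liouvilleMeasure κ).IsOpenPosMeasure := by
  refine ⟨fun U hU ⟨x, hx⟩ h0 ↦ ?_⟩
  set φ := chartAt (Cn n) x
  have hφ : φ ∈ atlas (Cn n) M := chart_mem_atlas _ x
  have hle : chartVolume κ φ ≤ liouvilleMeasure κ :=
    le_iSup₂ (f := fun φ (_ : φ ∈ atlas (Cn n) M) ↦ chartVolume κ φ) φ hφ
  have h1 : chartVolume κ φ U = 0 := le_antisymm ((hle U).trans_eq h0) bot_le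
  have hUo : IsOpen (φ.target ∩ φ.symm ⁻¹' U) := φ.isOpen_inter_preimage_symm hU
  have hdc := hκ.continuousOn_liouvilleDensity hφ
  rw [chartVolume_apply κ φ hU.measurableSet, lintegral_eq_zero_iff'
    ((hdc.mono Set.inter_subset_left).aemeasurable hUo.measurableSet).ennreal_ofReal] at h1
  have h2 := (ae_restrict_iff' hUo.measurableSet).1 h1
  have h3 : volume (φ.target ∩ φ.symm ⁻¹' U) = 0 := by
    refine measure_mono_null (fun z hz ↦ ?_) h2
    intro h4
    have h5 := h4 hz
    simp only [Pi.zero_apply, ENNReal.ofReal_eq_zero] at h5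
    exact absurd (hκ.liouvilleDensity_pos hφ hz.1) (not_lt.2 h5)
  have hxs : x ∈ φ.source := mem_chart_source _ x
  exact hUo.measure_ne_zero volume
    ⟨φ x, φ.map_source hxs, by simpa [φ.left_inv hxs] using hx⟩ h3

/-- The atlas may be infinite, so the supremum is dominated by one finite measure: finitely many
compact pieces cover `M`, and on each of them every chart volume is at most that of the chosen
chart, by agreement on overlaps. -/
theorem IsKahlerForm.isFiniteMeasure [IsManifold 𝓘(ℂ, Cn n) ω M] [CompactSpace M] [T2Space M]
    {κ : TwoForm n M} (hκ : IsKahlerForm κ) : IsFiniteMeasure (liouvilleMeasure κ) := by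
  have : LocallyCompactSpace M := ChartedSpace.locallyCompactSpace (Cn n) M
  have hK : ∀ x : M, ∃ K ∈ nhds x, K ⊆ (chartAt (Cn n) x).source ∧ IsCompact K := fun x ↦
    local_compact_nhds (chart_source_mem_nhds (Cn n) x)
  choose K hKn hKs hKc using hK
  obtain ⟨F, hF⟩ := isCompact_univ.elim_nhds_subcover K fun x _ ↦ hKn x
  have hfin : ∀ x, chartVolume κ (chartAt (Cn n) x) (K x) < ⊤ := by
    intro x
    set φ := chartAt (Cn n) x
    have hφ : φ ∈ atlas (Cn n) M := chart_mem_atlas _ x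
    rw [chartVolume_apply κ φ (hKc x).measurableSet]
    have himg : φ.target ∩ φ.symm ⁻¹' K x = φ '' K x := by
      rw [φ.image_eq_target_inter_inv_preimage (hKs x)]
    have hcomp : IsCompact (φ '' K x) := (hKc x).image_of_continuousOn
      (φ.continuousOn.mono (hKs x))
    rw [himg]
    have hcont : ContinuousOn (liouvilleDensity κ φ) (φ '' K x) :=
      (hκ.continuousOn_liouvilleDensity hφ).mono (himg ▸ Set.inter_subset_left)
    exact (hcont.integrableOn_compact hcomp).lintegral_lt_top
  let ν : Measure M := ∑ x ∈ F, (chartVolume κ (chartAt (Cn n) x)).restrict (K x)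
  have hle : liouvilleMeasure κ ≤ ν := by
    refine iSup₂_le fun φ hφ ↦ Measure.le_iff.2 fun S hS ↦ ?_
    have hcover : S ⊆ ⋃ x ∈ F, S ∩ K x := by
      intro y hy
      obtain ⟨x, hx, hyx⟩ := Set.mem_iUnion₂.1 (hF.2 (Set.mem_univ y))
      exact Set.mem_iUnion₂.2 ⟨x, hx, hy, hyx⟩
    calc chartVolume κ φ S ≤ ∑ x ∈ F, chartVolume κ φ (S ∩ K x) :=
          (measure_mono hcover).trans (measure_biUnion_finset_le _ _)
      _ ≤ ∑ x ∈ F, chartVolume κ (chartAt (Cn n) x) (S ∩ K x) := by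
          refine Finset.sum_le_sum fun x _ ↦ ?_
          have hm := hS.inter (hKc x).measurableSet
          rw [← chartVolume_inter_source κ φ hm, chartVolume_eq_of_subset κ hφ
            (chart_mem_atlas (Cn n) x) (hm.inter φ.open_source.measurableSet)
            Set.inter_subset_right fun y hy ↦ hKs x hy.1.2]
          exact measure_mono Set.inter_subset_left
      _ = ν S := by
          simp only [ν, Measure.finsetSum_apply]
          exact Finset.sum_congr rfl fun x _ ↦ (Measure.restrict_apply hS).symm
  refine ⟨(hle _).trans_lt ?_⟩
  simp only [ν, Measure.finsetSum_apply, Measure.restrict_apply_univ]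
  exact ENNReal.sum_lt_top.2 fun x _ ↦ hfin x

end Measure

/-! ### Riesz representation and matrix entries in an orthonormal basis. -/

section OrthonormalBasis

variable {V ι : Type*} [AddCommGroup V] [Module ℂ V] [Fintype ι] [DecidableEq ι]
  {B : V →ₗ⋆[ℂ] V →ₗ[ℂ] ℂ} {b : Module.Basis ι ℂ V}

omit [Fintype ι] in
theorem form_basis_left (hb : ∀ i j, B (b i) (b j) = if i = j then 1 else 0) (i : ι) (v : V) :
    B (b i) v = b.repr v i := by
  have h : B (b i) = b.coord i := b.ext fun j ↦ by simp [hb, Finsupp.single_apply, eq_comm]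
  rw [h, b.coord_apply]

theorem form_basis_right (hb : ∀ i j, B (b i) (b j) = if i = j then 1 else 0) (i : ι) (v : V) :
    B v (b i) = starRingEnd ℂ (b.repr v i) := by
  conv_lhs => rw [← b.sum_repr v]
  simp only [map_sum, LinearMap.sum_apply, map_smulₛₗ, LinearMap.smul_apply, hb]
  simp

theorem sum_form_smul_eq (hb : ∀ i j, B (b i) (b j) = if i = j then 1 else 0) (v : V) :
    ∑ i, B (b i) v • b i = v := by
  simp only [form_basis_left hb, b.sum_repr]

/-- Riesz representation, which produces the coherent vectors. The coefficients are conjugated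
because `B` is conjugate linear on the left. -/
theorem existsUnique_form_eq (hb : ∀ i j, B (b i) (b j) = if i = j then 1 else 0)
    (l : V →ₗ[ℂ] ℂ) : ∃! e, ∀ s, B e s = l s := by
  refine ⟨∑ i, starRingEnd ℂ (l (b i)) • b i, fun s ↦ ?_, fun e he ↦ ?_⟩
  · have : B (∑ i, starRingEnd ℂ (l (b i)) • b i) = l := b.ext fun j ↦ by simp [hb]
    rw [this]
  · conv_lhs => rw [← b.sum_repr e]
    refine Finset.sum_congr rfl fun i _ ↦ ?_
    rw [← he (b i), form_basis_right hb, starRingEnd_self_apply]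

/-- With `Q u s = ⟨u, f s⟩` the resulting operator is `T_f`. -/
theorem existsUnique_end_form_eq (hb : ∀ i j, B (b i) (b j) = if i = j then 1 else 0)
    (Q : V →ₗ⋆[ℂ] V →ₗ[ℂ] ℂ) : ∃! A : Module.End ℂ V, ∀ s u, Q u s = B u (A s) := by
  refine ⟨∑ i, (Q (b i)).smulRight (b i), fun s u ↦ ?_, fun A hA ↦ ?_⟩
  · conv_lhs => rw [← b.sum_repr u]
    simp only [map_sum, LinearMap.sum_apply, map_smulₛₗ, LinearMap.smul_apply,
      LinearMap.smulRight_apply, form_basis_right hb, smul_eq_mul, RingHom.id_apply, mul_comm]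
  · refine LinearMap.ext fun s ↦ ?_
    rw [← sum_form_smul_eq hb (A s)]
    simp [← hA]

/-- Expansion of `A` in the matrix units `|b i⟩⟨b j|`; the values of `l` on these are the
coefficients `c i j` of the duality argument. -/
theorem dual_end_apply_eq_sum (hb : ∀ i j, B (b i) (b j) = if i = j then 1 else 0)
    (l : Module.Dual ℂ (Module.End ℂ V)) (A : Module.End ℂ V) :
    l A = ∑ i, ∑ j, l ((B (b j)).smulRight (b i)) * B (b i) (A (b j)) := by
  have hA : A = ∑ i, ∑ j, B (b i) (A (b j)) • (B (b j)).smulRight (b i) := by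
    refine b.ext fun k ↦ ?_
    conv_lhs => rw [← sum_form_smul_eq hb (A (b k))]
    simp [hb]
  conv_lhs => rw [hA]
  simp [mul_comm]

end OrthonormalBasis

/-! ### Toeplitz operators, coherent vectors and the duality argument. -/

section Toeplitz

variable {n : ℕ} {M : Type*} [TopologicalSpace M] [ChartedSpace (Cn n) M]
  [IsManifold 𝓘(ℂ, Cn n) ω M] [CompactSpace M]
  [MeasurableSpace M] [BorelSpace M]
  {L : M → Type*} [TopologicalSpace (Bundle.TotalSpace ℂ L)]
  [∀ x, AddCommGroup (L x)] [∀ x, Module ℂ (L x)] [∀ x, TopologicalSpace (L x)]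
  [FiberBundle ℂ L] [VectorBundle ℂ ℂ L] [ContMDiffVectorBundle ω ℂ L 𝓘(ℂ, Cn n)]
  (κ : TwoForm n M) [IsFiniteMeasure (liouvilleMeasure κ)] (h : HermitianMetric n L)

omit [CompactSpace M] [MeasurableSpace M] [BorelSpace M] [IsManifold 𝓘(ℂ, Cn n) ω M] in
theorem continuous_form (s t : HolSection n L) : Continuous fun x ↦ h.form x (s x) (t x) :=
  (contMDiff_form h s t).continuous

omit [IsManifold 𝓘(ℂ, Cn n) ω M] in
theorem integrable_mul_form (f : C(M, ℂ)) (s t : HolSection n L) :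
    Integrable (fun x ↦ f x * h.form x (s x) (t x)) (liouvilleMeasure κ) :=
  (f.continuous.mul (continuous_form h s t)).integrable_of_hasCompactSupport
    (HasCompactSupport.of_compactSpace _)

/-- The sesquilinear form `(u, s) ↦ ⟨u, f s⟩` on holomorphic sections. -/
def weightedForm (f : C(M, ℂ)) : HolSection n L →ₗ⋆[ℂ] HolSection n L →ₗ[ℂ] ℂ :=
  LinearMap.mk₂'ₛₗ (starRingEnd ℂ) (RingHom.id ℂ)
    (fun u s ↦ ∫ x, f x * h.form x (u x) (s x) ∂(liouvilleMeasure κ))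
    (fun u v s ↦ by
      rw [← integral_add (integrable_mul_form κ h f u s) (integrable_mul_form κ h f v s)]
      simp [mul_add])
    (fun a u s ↦ by
      rw [smul_eq_mul, ← integral_const_mul]
      simp [mul_left_comm])
    (fun u s t ↦ by
      rw [← integral_add (integrable_mul_form κ h f u s) (integrable_mul_form κ h f u t)]
      simp [mul_add])
    (fun a u s ↦ by
      rw [smul_eq_mul, ← integral_const_mul]
      simp [mul_left_comm])

omit [IsManifold 𝓘(ℂ, Cn n) ω M] in
theorem weightedForm_apply (f : C(M, ℂ)) (u s : HolSection n L) :
    weightedForm κ h f u s = ∫ x, f x * h.form x (u x) (s x) ∂(liouvilleMeasure κ) := rfl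

omit [IsManifold 𝓘(ℂ, Cn n) ω M] in
theorem l2Inner_eq_weightedForm (u s : HolSection n L) :
    l2Inner κ h u s = weightedForm κ h 1 u s := by
  simp [weightedForm_apply, l2Inner]

/-- The continuous function underlying a smooth function. -/
def SmoothFun.toContinuousMap (f : SmoothFun n M) : C(M, ℂ) := ⟨f, f.contMDiff.continuous⟩

omit [IsManifold 𝓘(ℂ, Cn n) ω M] in
theorem isToeplitz_iff (f : SmoothFun n M) (A : Module.End ℂ (HolSection n L)) :
    IsToeplitz κ h f A ↔
      ∀ s u, weightedForm κ h f.toContinuousMap u s = weightedForm κ h 1 u (A s) := by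
  refine forall₂_congr fun s u ↦ ?_
  rw [l2Inner_eq_weightedForm, weightedForm_apply κ h f.toContinuousMap, l2Inner]
  simp [SmoothFun.toContinuousMap]

omit [IsManifold 𝓘(ℂ, Cn n) ω M] in
theorem conj_weightedForm_one (u v : HolSection n L) :
    starRingEnd ℂ (weightedForm κ h 1 u v) = weightedForm κ h 1 v u := by
  rw [weightedForm_apply, weightedForm_apply, ← integral_conj]
  simp [h.conj_symm]

omit [IsManifold 𝓘(ℂ, Cn n) ω M] in
theorem weightedForm_one_pos [(liouvilleMeasure κ).IsOpenPosMeasure] (u : HolSection n L)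
    (hu : u ≠ 0) : 0 < (weightedForm κ h 1 u u).re := by
  obtain ⟨x, hx⟩ : ∃ x, u x ≠ 0 := by
    by_contra! h0
    exact hu (ContMDiffSection.ext fun x ↦ h0 x)
  have hre : (weightedForm κ h 1 u u).re =
      ∫ x, (h.form x (u x) (u x)).re ∂(liouvilleMeasure κ) := by
    have := integral_re (𝕜 := ℂ) (integrable_mul_form κ h 1 u u)
    simpa [weightedForm_apply] using this.symm
  rw [hre]
  exact (Complex.continuous_re.comp
    (continuous_form h u u)).integral_pos_of_hasCompactSupport_nonneg_nonzero
    (HasCompactSupport.of_compactSpace _) (fun y ↦ h.form_self_re_nonneg _) (h.pos x _ hx).ne'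

/-- The smooth function `x ↦ ∑ conj (cᵢⱼ h(bᵢ, bⱼ))`. -/
def conjSumForm {ι : Type*} [Fintype ι] (b : ι → HolSection n L) (c : ι → ι → ℂ) :
    SmoothFun n M where
  val x := starRingEnd ℂ (∑ i, ∑ j, c i j * h.form x (b i x) (b j x))
  property := by
    have h1 : ContMDiff 𝓘(ℝ, Cn n) 𝓘(ℝ, ι → ι → ℂ) ∞ fun x i j ↦ h.form x (b i x) (b j x) :=
      contMDiff_pi_space.2 fun i ↦ contMDiff_pi_space.2 fun j ↦ contMDiff_form h (b i) (b j)
    have h2 : ContDiff ℝ ∞ fun y : ι → ι → ℂ ↦ Complex.conjCLE (∑ i, ∑ j, c i j * y i j) := by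
      fun_prop
    exact h2.contMDiff.comp h1

variable {ι : Type*} [Fintype ι] [DecidableEq ι] {b : Module.Basis ι ℂ (HolSection n L)}

-- This is the pairing `l (T_f) = ∫ f K Ω`, needed both for surjectivity and for the contravariant
-- symbol.
omit [DecidableEq ι] [IsManifold 𝓘(ℂ, Cn n) ω M] in
theorem sum_mul_weightedForm (f : C(M, ℂ)) (c : ι → ι → ℂ) :
    Integrable (fun x ↦ f x * ∑ i, ∑ j, c i j * h.form x (b i x) (b j x)) (liouvilleMeasure κ) ∧
    ∑ i, ∑ j, c i j * weightedForm κ h f (b i) (b j) =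
      ∫ x, f x * ∑ i, ∑ j, c i j * h.form x (b i x) (b j x) ∂(liouvilleMeasure κ) := by
  have hint : ∀ i j, Integrable (fun x ↦ c i j * (f x * h.form x (b i x) (b j x)))
      (liouvilleMeasure κ) := fun i j ↦ (integrable_mul_form κ h f _ _).const_mul _
  have heq : (fun x ↦ f x * ∑ i, ∑ j, c i j * h.form x (b i x) (b j x)) =
      fun x ↦ ∑ i, ∑ j, c i j * (f x * h.form x (b i x) (b j x)) := by
    ext x
    simp only [Finset.mul_sum, mul_left_comm]
  rw [heq]
  refine ⟨integrable_finsetSum _ fun i _ ↦ integrable_finsetSum _ fun j _ ↦ hint i j, ?_⟩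
  rw [integral_finsetSum _ fun i _ ↦ integrable_finsetSum _ fun j _ ↦ hint i j]
  refine Finset.sum_congr rfl fun i _ ↦ ?_
  rw [integral_finsetSum _ fun j _ ↦ hint i j]
  exact Finset.sum_congr rfl fun j _ ↦ (integral_const_mul _ _).symm

/-- The Toeplitz operators form a subspace, so it is enough that a functional vanishing on all of
them is zero. -/
theorem exists_isToeplitz [ConnectedSpace M] [(liouvilleMeasure κ).IsOpenPosMeasure]
    (hb : ∀ i j, weightedForm κ h 1 (b i) (b j) = if i = j then 1 else 0)
    (A : Module.End ℂ (HolSection n L)) : ∃ f : SmoothFun n M, IsToeplitz κ h f A := by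
  let S : Submodule ℂ (Module.End ℂ (HolSection n L)) :=
    { carrier := {A | ∃ f : SmoothFun n M, IsToeplitz κ h f A}
      zero_mem' := ⟨0, fun s u ↦ by simp [l2Inner]⟩
      add_mem' := by
        rintro A A' ⟨f, hf⟩ ⟨g, hg⟩
        refine ⟨f + g, (isToeplitz_iff κ h _ _).2 fun s u ↦ ?_⟩
        rw [LinearMap.add_apply, map_add, ← (isToeplitz_iff κ h f A).1 hf,
          ← (isToeplitz_iff κ h g A').1 hg]
        simp only [weightedForm_apply]
        rw [← integral_add (integrable_mul_form κ h _ _ _) (integrable_mul_form κ h _ _ _)]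
        simp [SmoothFun.toContinuousMap, add_mul]
      smul_mem' := by
        rintro a A ⟨f, hf⟩
        refine ⟨⟨fun x ↦ a * f x, (contDiff_const.mul contDiff_id).contMDiff.comp f.contMDiff⟩,
          (isToeplitz_iff κ h _ _).2 fun s u ↦ ?_⟩
        rw [LinearMap.smul_apply, map_smul, ← (isToeplitz_iff κ h f A).1 hf, smul_eq_mul]
        simp only [weightedForm_apply]
        rw [← integral_const_mul]
        simp [SmoothFun.toContinuousMap, mul_assoc] }
  suffices hS : S = ⊤ from (hS ▸ Submodule.mem_top : A ∈ S)
  by_contra hne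
  obtain ⟨l, hl0, hl⟩ := Submodule.exists_le_ker_of_lt_top S (lt_top_iff_ne_top.2 hne)
  set c : ι → ι → ℂ := fun i j ↦ l ((weightedForm κ h 1 (b j)).smulRight (b i)) with hc
  -- The test function `conj K`, for which `l (T_f)` is the squared `L²` norm of `K`.
  set f := conjSumForm h b c
  obtain ⟨T, hT, -⟩ := existsUnique_end_form_eq hb (weightedForm κ h f.toContinuousMap)
  have hlT : l T = 0 := hl (show T ∈ S from ⟨f, (isToeplitz_iff κ h f T).2 hT⟩)
  have hcont : Continuous fun x ↦ ∑ i, ∑ j, c i j * h.form x (b i x) (b j x) :=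
    continuous_finsetSum _ fun i _ ↦ continuous_finsetSum _ fun j _ ↦
      continuous_const.mul (continuous_form h _ _)
  have hK : ∫ x, ‖∑ i, ∑ j, c i j * h.form x (b i x) (b j x)‖ ^ 2 ∂(liouvilleMeasure κ) = 0 := by
    rw [dual_end_apply_eq_sum hb] at hlT
    simp only [← hT] at hlT
    rw [(sum_mul_weightedForm κ h f.toContinuousMap c).2] at hlT
    have h1 : ∀ x, f.toContinuousMap x * ∑ i, ∑ j, c i j * h.form x (b i x) (b j x) =
        ((‖∑ i, ∑ j, c i j * h.form x (b i x) (b j x)‖ ^ 2 : ℝ) : ℂ) := by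
      intro x
      push_cast
      rw [← Complex.conj_mul']
      rfl
    simp only [h1] at hlT
    rw [integral_complex_ofReal] at hlT
    exact_mod_cast hlT
  have hK0 : ∀ x, ∑ i, ∑ j, c i j * h.form x (b i x) (b j x) = 0 := by
    by_contra! hx
    obtain ⟨x, hx⟩ := hx
    refine (hcont.norm.pow 2).integral_pos_of_hasCompactSupport_nonneg_nonzero
      (μ := liouvilleMeasure κ) (HasCompactSupport.of_compactSpace _) (fun y ↦ sq_nonneg _)
      (x := x) (by simpa using hx) |>.ne' hK
  have hc0 := coeff_eq_zero_of_sum_form_eq_zero h b.linearIndependent c hK0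
  refine hl0 (LinearMap.ext fun A ↦ ?_)
  rw [dual_end_apply_eq_sum hb]
  exact Finset.sum_eq_zero fun i _ ↦ Finset.sum_eq_zero fun j _ ↦ by
    rw [show l _ = 0 from hc0 i j, zero_mul]

omit [IsManifold 𝓘(ℂ, Cn n) ω M] in
theorem isCoherentVector_iff {x : M} (q : L x) (e : HolSection n L) :
    IsCoherentVector κ h q e ↔ ∀ s, weightedForm κ h 1 e s = evalForm h q s :=
  forall_congr' fun s ↦ by rw [l2Inner_eq_weightedForm]

omit [IsManifold 𝓘(ℂ, Cn n) ω M] in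
/-- In an orthonormal basis the operator `P_x ε(x)` has the matrix entries `h(bᵢ(x), bⱼ(x))`. -/
theorem dual_coherentProjector_mul_epsilon [(liouvilleMeasure κ).IsOpenPosMeasure]
    (hb : ∀ i j, weightedForm κ h 1 (b i) (b j) = if i = j then 1 else 0)
    (l : Module.Dual ℂ (Module.End ℂ (HolSection n L))) {x : M} {q : L x} (hq : q ≠ 0)
    (hx : ∃ s : HolSection n L, s x ≠ 0) :
    l (coherentProjector κ h q) * rawnsleyEpsilon κ h q =
      ∑ i, ∑ j, l ((weightedForm κ h 1 (b j)).smulRight (b i)) * h.form x (b i x) (b j x) := by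
  have hex : ∃ e, IsCoherentVector κ h q e := by
    obtain ⟨e, he, -⟩ := existsUnique_form_eq hb (evalForm h q)
    exact ⟨e, (isCoherentVector_iff κ h q e).2 he⟩
  have he : ∀ s, weightedForm κ h 1 (coherentVector κ h q) s = evalForm h q s := by
    rw [← isCoherentVector_iff, coherentVector, dif_pos hex]
    exact hex.choose_spec
  rw [coherentProjector, rawnsleyEpsilon, map_smul, smul_eq_mul]
  set e := coherentVector κ h q
  -- If `e_q` were zero, every section would vanish at `x`, against `hx`.
  have hN : l2Inner κ h e e ≠ 0 := by
    rw [l2Inner_eq_weightedForm]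
    intro h0
    have he0 : e = 0 := by
      by_contra hne
      have := weightedForm_one_pos κ h e hne
      simp [h0] at this
    obtain ⟨s, hs⟩ := hx
    apply hs
    rw [← evalForm_smul h q hq s, ← he s, he0]
    simp
  have h1 : (l2Inner κ h e e)⁻¹ * l ((evalForm h q).smulRight e) *
      (h.form x q q * l2Inner κ h e e) = l ((evalForm h q).smulRight e) * h.form x q q := by
    field_simp
  rw [h1, dual_end_apply_eq_sum hb, Finset.sum_mul]
  refine Finset.sum_congr rfl fun i _ ↦ ?_
  rw [Finset.sum_mul]
  refine Finset.sum_congr rfl fun j _ ↦ ?_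
  -- `⟨b i, e_q⟩` is the conjugate of `q̂(b i)`, and `h(q, q) conj(q̂(b i)) q̂(b j) = h(b i, b j)`
  -- at `x`, since `b i x = q̂(b i) q`.
  rw [← evalForm_smul h q hq (b i), ← evalForm_smul h q hq (b j), LinearMap.smulRight_apply,
    map_smul, ← conj_weightedForm_one κ h e, he]
  simp only [map_smulₛₗ, LinearMap.smul_apply, smul_eq_mul, RingHom.id_apply]
  ring

end Toeplitz

end BerezinToeplitz

end

open BerezinToeplitz in
theorem proposition3p3 {n : ℕ} {M : Type*} [TopologicalSpace M] [ChartedSpace (Cn n) M]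
    [IsManifold 𝓘(ℂ, Cn n) ω M] [CompactSpace M] [T2Space M] [ConnectedSpace M]
    [MeasurableSpace M] [BorelSpace M]
    {L : M → Type*} [TopologicalSpace (Bundle.TotalSpace ℂ L)]
    [∀ x, AddCommGroup (L x)] [∀ x, Module ℂ (L x)] [∀ x, TopologicalSpace (L x)]
    [FiberBundle ℂ L] [VectorBundle ℂ ℂ L] [ContMDiffVectorBundle ω ℂ L 𝓘(ℂ, Cn n)]
    (κ : TwoForm n M) (hκ : IsKahlerForm κ)
    (h : HermitianMetric n L) (m : ℕ) (hm : 1 ≤ m) (hL : IsQuantumLineBundle κ h m) :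
    FiniteDimensional ℂ (HolSection n L) ∧
    (∀ f : SmoothFun n M, ∃! A, IsToeplitz κ h f A) ∧
    Function.Surjective (toeplitz κ h : SmoothFun n M → Module.End ℂ (HolSection n L)) ∧
    (∀ (x : M) (q : L x), q ≠ 0 → ∃! e, IsCoherentVector κ h q e) ∧
    ((∀ x : M, ∃ s : HolSection n L, s x ≠ 0) →
      ∀ A : Module.End ℂ (HolSection n L), ∃ f : SmoothFun n M, IsContravariantSymbol κ h A f) := by
  have hfd : FiniteDimensional ℂ (HolSection n L) := finiteDimensional_holSection h
  have := hκ.isFiniteMeasure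
  have := hκ.isOpenPosMeasure
  obtain ⟨b, hb⟩ := exists_basis_orthonormal (weightedForm κ h 1) (conj_weightedForm_one κ h)
    (weightedForm_one_pos κ h) rfl
  have hT : ∀ f : SmoothFun n M, ∃! A, IsToeplitz κ h f A := fun f ↦ by
    simp only [isToeplitz_iff]
    exact existsUnique_end_form_eq hb _
  refine ⟨hfd, hT, fun A ↦ ?_, fun x q _ ↦ ?_, fun hbase A ↦ ?_⟩
  · obtain ⟨f, hf⟩ := exists_isToeplitz κ h hb A
    refine ⟨f, ?_⟩
    rw [toeplitz, dif_pos ⟨A, hf⟩]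
    exact (hT f).unique (Exists.choose_spec _) hf
  · simp only [isCoherentVector_iff]
    exact existsUnique_form_eq hb _
  -- Any `f` with `T_f = A` is a contravariant symbol of `A`.
  · obtain ⟨f, hf⟩ := exists_isToeplitz κ h hb A
    refine ⟨f, fun q hq l ↦ ?_⟩
    simp only [mul_assoc, dual_coherentProjector_mul_epsilon κ h hb l (hq _) (hbase _)]
    have hs := sum_mul_weightedForm κ h (b := b) f.toContinuousMap
      (fun i j ↦ l ((weightedForm κ h 1 (b j)).smulRight (b i)))
    refine ⟨hs.1, ?_⟩
    rw [dual_end_apply_eq_sum hb]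
    simp only [← (isToeplitz_iff κ h f A).1 hf]
    exact hs.2
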